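/- **Lemma (weighted lowest stabbing queries).** Let $S$ be a set of $n = |S|$ horizontal segments on the integer grid, given as an array. Each segment $s = ([\ell_s, r_s], y_s, w_s)$ consists of the points $(x, y_s)$ with $\ell_s \le x \le r_s$ and has an integer weight $w_s$. A *weighted lowest stabbing query* (WLSQ) is given by integers $v, w_1, w_2$. It asks for a lowest segment $s \in S$, that is, one with the smallest $y_s$, among those that are stabbed by the vertical line $x = v$ (i.e. $\ell_s \le v \le r_s$) and have weight $w_1 \le w_s \le w_2$. The answer is the index of such a segment in the array, or $-1$ if there is none. On a word RAM (unit-cost instructions: constants, reads and writes of registers and of memory cells, addition, subtraction, multiplication, integer division, comparison, conditional and loop control), one can build from $S$, in $O(n \log n)$ time, a data structure of size $O(n \log n)$ words that answers every WLSQ in $O(\log n)$ time. Precisely, there are a fixed preprocessing program, a fixed query program and a constant $C$ such that the following holds for every $n \ge 0$, every word length and every $S$ for which the input numbers are machine words and a memory of $M = C(n \lfloor\log_2 n\rfloor + 1)$ cells is addressable by a word, where $0\cdot\lfloor\log_2 0\rfloor := 0$ and $\lfloor\log_2 0\rfloor := 0$. Words are the integers in $[-2^b, 2^b)$, arithmetic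 is modulo $2^{b+1}$, and addressability means $M \le 2^b$. * Started with $n$ and the array of segments in a memory of $M$ cells that are otherwise $0$, the preprocessing program halts after at most $C(n \lfloor\log_2 n\rfloor + 1)$ steps. The contents of the $M$ cells at that point are the data structure. * For all words $v, w_1, w_2$, the query program, started on this data structure with $v, w_1, w_2$ in registers, halts after at most $C(\lfloor\log_2 n\rfloor + 1)$ steps with a correct answer to the WLSQ $(v, w_1, w_2)$ in a register, and leaves the data structure unchanged. -/

import Mathlib

namespace WLSQ

/-! ### Weighted lowest stabbing queries -/

/-- A weighted horizontal segment on the integer grid: the points `(x, height)` with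
`left ≤ x ≤ right`, together with an integer weight. -/
structure Segment where
  left : ℤ
  right : ℤ
  height : ℤ
  weight : ℤ
  left_le_right : left ≤ right

/-- The segment is stabbed by the vertical line `x = v`, and its weight is between `w₁` and `w₂`. -/
def Segment.Matches (s : Segment) (v w₁ w₂ : ℤ) : Prop :=
  (s.left ≤ v ∧ v ≤ s.right) ∧ (w₁ ≤ s.weight ∧ s.weight ≤ w₂)

/-- `out` is a correct answer to the query `(v, w₁, w₂)` on the segments `S`: it is the index of a
lowest segment among those that match the query, or `-1` if no segment matches. -/
def IsAnswer (S : List Segment) (v w₁ w₂ out : ℤ) : Prop :=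
  (out = -1 ∧ ∀ s ∈ S, ¬ s.Matches v w₁ w₂) ∨
    ∃ i : Fin S.length, out = ((i : ℕ) : ℤ) ∧ (S.get i).Matches v w₁ w₂ ∧
      ∀ s ∈ S, s.Matches v w₁ w₂ → (S.get i).height ≤ s.height

/-! ### The word RAM

Machine words are the integers in `[-2 ^ b, 2 ^ b)`, that is, `b + 1`-bit words in two's complement.
The machine has registers and a random access memory of `M` cells, each of which holds a word.
A program is a finite piece of code, so that it uses only a constant number of registers. -/

/-- `x` is a word. -/
def Fits (b : ℕ) (x : ℤ) : Prop :=
  -2 ^ b ≤ x ∧ x < 2 ^ b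

/-- Reduction of an integer modulo `2 ^ (b + 1)` to a word. -/
def wrap (b : ℕ) (x : ℤ) : ℤ :=
  Int.bmod x (2 ^ (b + 1))

/-- All the numbers that describe the segment are words. -/
def Segment.Fits (b : ℕ) (s : Segment) : Prop :=
  WLSQ.Fits b s.left ∧ WLSQ.Fits b s.right ∧ WLSQ.Fits b s.height ∧ WLSQ.Fits b s.weight

/-- The arithmetic operations and comparisons of the machine. -/
inductive BinOp where
  | add | sub | mul | div | lt | eq

/-- The exact integer result of an operation; comparisons give `1` (true) or `0` (false), and
division by `0` gives `0`. -/
def BinOp.apply : BinOp → ℤ → ℤ → ℤ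
  | add, x, y => x + y
  | sub, x, y => x - y
  | mul, x, y => x * y
  | div, x, y => x / y
  | lt, x, y => if x < y then 1 else 0
  | eq, x, y => if x = y then 1 else 0

/-- Expressions: constants, registers, operations, and the memory cell at a computed address. -/
inductive Expr where
  | const (c : ℤ)
  | reg (x : ℕ)
  | op (o : BinOp) (e f : Expr)
  | load (e : Expr)

/-- Programs. A condition is true when its value is not `0`. -/
inductive Cmd where
  | skip
  | assign (x : ℕ) (e : Expr)
  | store (addr e : Expr)
  | seq (c d : Cmd)
  | ite (e : Expr) (c d : Cmd)
  | while (e : Expr) (c : Cmd)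

/-- The contents of the registers and of the memory. Only the cells below the memory size `M`
are accessible to a program. -/
structure State where
  reg : ℕ → ℤ
  mem : ℕ → ℤ

/-- The value of an expression; `none` when an address outside of `0, …, M - 1` is accessed. -/
def Expr.value (b M : ℕ) (σ : State) : Expr → Option ℤ
  | const c => some (wrap b c)
  | reg x => some (σ.reg x)
  | op o e f =>
    (e.value b M σ).bind fun x => (f.value b M σ).bind fun y => some (wrap b (o.apply x y))
  | load e =>
    (e.value b M σ).bind fun a => if 0 ≤ a ∧ a < (M : ℤ) then some (σ.mem a.toNat) else none

/-- The number of steps needed to evaluate an expression: one for every constant, register access,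
operation and memory access in it. -/
def Expr.cost : Expr → ℕ
  | const _ => 1
  | reg _ => 1
  | op _ e f => e.cost + f.cost + 1
  | load e => e.cost + 1

/-- `Exec b M c σ t τ`: with words of `b + 1` bits and a memory of `M` cells, the program `c`,
started in the state `σ`, halts in the state `τ` after exactly `t` steps. A program that accesses
an address outside of `0, …, M - 1` crashes, and has no such `t` and `τ`. -/
inductive Exec (b M : ℕ) : Cmd → State → ℕ → State → Prop where
  | skip (σ : State) : Exec b M Cmd.skip σ 1 σ
  | assign (σ : State) (x : ℕ) (e : Expr) (z : ℤ) (h : e.value b M σ = some z) :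
      Exec b M (Cmd.assign x e) σ (e.cost + 1) ⟨Function.update σ.reg x z, σ.mem⟩
  | store (σ : State) (f e : Expr) (a : ℕ) (z : ℤ) (hf : f.value b M σ = some (a : ℤ))
      (ha : a < M) (he : e.value b M σ = some z) :
      Exec b M (Cmd.store f e) σ (f.cost + e.cost + 1) ⟨σ.reg, Function.update σ.mem a z⟩
  | seq (c d : Cmd) (σ σ' σ'' : State) (t t' : ℕ) (hc : Exec b M c σ t σ')
      (hd : Exec b M d σ' t' σ'') : Exec b M (Cmd.seq c d) σ (t + t') σ''
  | ite_true (e : Expr) (c d : Cmd) (σ σ' : State) (z : ℤ) (t : ℕ)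
      (h : e.value b M σ = some z) (hz : z ≠ 0) (hc : Exec b M c σ t σ') :
      Exec b M (Cmd.ite e c d) σ (e.cost + 1 + t) σ'
  | ite_false (e : Expr) (c d : Cmd) (σ σ' : State) (t : ℕ)
      (h : e.value b M σ = some 0) (hd : Exec b M d σ t σ') :
      Exec b M (Cmd.ite e c d) σ (e.cost + 1 + t) σ'
  | while_true (e : Expr) (c : Cmd) (σ σ' σ'' : State) (z : ℤ) (t t' : ℕ)
      (h : e.value b M σ = some z) (hz : z ≠ 0) (hc : Exec b M c σ t σ')
      (hw : Exec b M (Cmd.while e c) σ' t' σ'') :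
      Exec b M (Cmd.while e c) σ (e.cost + 1 + t + t') σ''
  | while_false (e : Expr) (c : Cmd) (σ : State) (h : e.value b M σ = some 0) :
      Exec b M (Cmd.while e c) σ (e.cost + 1) σ

/-! ### Input conventions -/

/-- The memory that holds the input: the number of segments, then four words for each segment,
and `0` in all other cells. -/
def inputMem (S : List Segment) (a : ℕ) : ℤ :=
  ((S.length : ℤ) :: S.flatMap fun s => [s.left, s.right, s.height, s.weight]).getD a 0

/-- The state in which the preprocessing starts. -/
def buildStart (S : List Segment) : State :=
  ⟨fun _ => 0, inputMem S⟩

/-- The state in which a query starts: the query is in the registers `0`, `1`, `2`, all other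
registers hold `0`, and the memory holds the data structure `D`. -/
def queryStart (D : ℕ → ℤ) (v w₁ w₂ : ℤ) : State :=
  ⟨fun x => [v, w₁, w₂].getD x 0, D⟩

end WLSQ

/-!
A segment is *active* at the abscissa `v` if it is stabbed by the line `x = v`. When `v` moves from
left to right, the set of active segments changes at `2 * n` events only: a segment is inserted at
its left endpoint, and deleted after its right one. The data structure is a persistent tournament
tree. Its leaves are the segments, sorted by weight, and every node holds the lowest active segment
below it. An event changes one leaf, and all that it takes is a new record for each of the `O(log
n)` nodes on the path from that leaf to the root (`runs_update`), while the old records stay, so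
that each of the `2 * n + 1` versions of the tree can still be reached from its root (`Rep.frame`,
`runs_sweep`). The same update, on the same tree, sorts the events and the weights: insert all the
items, then take the winner from the root again and again (`runs_sort`).

A query finds by binary search the version that belongs to `v`, and the range of leaves that belongs
to `[w₁, w₂]` (`runs_search`). Two pointers then go down from the root of this version to the leaves
just outside of the range. At every level, the nodes strictly between the two pointers cover a part
of the range, which grows by at most two nodes with every step (`DescentInv.step`).

Segments and events are represented by positive codes, and the code `0` stands for the absence of an
item. As the memory is filled with zeros at the start, the null record at the address `0` therefore
is the empty tree of any height (`Rep.null`), and nothing has to be initialized. Ties are broken by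
the codes, which makes all orders strict; since the insertions have smaller codes than the
deletions, insertions come first at each abscissa.

Programs are verified in terms of exact integer arithmetic (`Expr.eval`), under side conditions
which say that nothing overflows and all addresses are valid (`Expr.Ok`). Both follow from the bound
on the number of records, since all the computed numbers are codes or addresses.
-/

namespace WLSQ

/-! ### Programs and total correctness with time bounds -/

instance : Add Expr := ⟨Expr.op .add⟩
instance : Sub Expr := ⟨Expr.op .sub⟩
instance : Mul Expr := ⟨Expr.op .mul⟩
instance : Div Expr := ⟨Expr.op .div⟩
instance (i : ℕ) : OfNat Expr i := ⟨Expr.const i⟩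

/-- The test `e < f`, with value `1` or `0`. -/
def Expr.lt (e f : Expr) : Expr := .op .lt e f

/-- The test `e = f`, with value `1` or `0`. -/
def Expr.eq (e f : Expr) : Expr := .op .eq e f

/-- The value of an expression in exact integer arithmetic, without a bound on addresses. -/
def Expr.eval (σ : State) : Expr → ℤ
  | const c => c
  | reg x => σ.reg x
  | op o e f => o.apply (e.eval σ) (f.eval σ)
  | load e => σ.mem (e.eval σ).toNat

/-- The operation does not overflow on the operands `x` and `y`. -/
def BinOp.Safe (b : ℕ) : BinOp → ℤ → ℤ → Prop
  | add, x, y => Fits b (x + y)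
  | sub, x, y => Fits b (x - y)
  | mul, x, y => Fits b (x * y)
  | div, x, y => Fits b (x / y)
  | lt, _, _ => 1 ≤ b
  | eq, _, _ => 1 ≤ b

/-- The evaluation of the expression involves neither an overflow nor an address outside of the
memory, so that its value on the machine is the exact one. -/
def Expr.Ok (b M : ℕ) (σ : State) : Expr → Prop
  | const c => Fits b c
  | reg _ => True
  | op o e f => e.Ok b M σ ∧ f.Ok b M σ ∧ o.Safe b (e.eval σ) (f.eval σ)
  | load e => e.Ok b M σ ∧ 0 ≤ e.eval σ ∧ e.eval σ < M

theorem wrap_of_fits {b : ℕ} {x : ℤ} (h : Fits b x) : wrap b x = x := by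
  obtain ⟨h₁, h₂⟩ := h
  have h2 : (2 : ℤ) ^ (b + 1) = 2 * 2 ^ b := by ring
  unfold wrap
  apply Int.bmod_eq_of_le_mul_two
  · push_cast
    omega
  · push_cast
    omega

theorem BinOp.Safe.fits {b : ℕ} {o : BinOp} {x y : ℤ} (h : o.Safe b x y) :
    Fits b (o.apply x y) := by
  cases o
  case lt | eq =>
    have hb : 1 ≤ b := h
    have : (2 : ℤ) ^ 1 ≤ 2 ^ b := pow_le_pow_right₀ (by norm_num) hb
    simp only [BinOp.apply, Fits]
    split <;> constructor <;> omega
  all_goals exact h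

theorem Expr.Ok.value_eq {b M : ℕ} {σ : State} {e : Expr} (h : e.Ok b M σ) :
    e.value b M σ = some (e.eval σ) := by
  induction e with
  | const c => simp [Expr.value, Expr.eval, wrap_of_fits h]
  | reg x => rfl
  | op o e f he hf =>
    simp [Expr.value, Expr.eval, he h.1, hf h.2.1, wrap_of_fits h.2.2.fits]
  | load e he =>
    simp [Expr.value, Expr.eval, he h.1, h.2.1, h.2.2]

section Simp

variable (b M : ℕ) (σ : State) (e f : Expr) (x : ℕ)

@[simp] theorem Expr.eval_reg : (Expr.reg x).eval σ = σ.reg x := rfl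
@[simp] theorem Expr.eval_add : (e + f).eval σ = e.eval σ + f.eval σ := rfl
@[simp] theorem Expr.eval_sub : (e - f).eval σ = e.eval σ - f.eval σ := rfl
@[simp] theorem Expr.eval_mul : (e * f).eval σ = e.eval σ * f.eval σ := rfl
@[simp] theorem Expr.eval_div : (e / f).eval σ = e.eval σ / f.eval σ := rfl
@[simp] theorem Expr.eval_lt :
    (e.lt f).eval σ = if e.eval σ < f.eval σ then 1 else 0 := rfl
@[simp] theorem Expr.eval_eq :
    (e.eq f).eval σ = if e.eval σ = f.eval σ then 1 else 0 := rfl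
@[simp] theorem Expr.eval_ofNat :
    (no_index (OfNat.ofNat x) : Expr).eval σ = ((OfNat.ofNat x : ℕ) : ℤ) := rfl
@[simp] theorem Expr.eval_load : (Expr.load e).eval σ = σ.mem (e.eval σ).toNat := rfl

@[simp] theorem Expr.ok_reg : (Expr.reg x).Ok b M σ ↔ True := Iff.rfl
@[simp] theorem Expr.ok_add : (e + f).Ok b M σ ↔
    e.Ok b M σ ∧ f.Ok b M σ ∧ Fits b (e.eval σ + f.eval σ) := Iff.rfl
@[simp] theorem Expr.ok_sub : (e - f).Ok b M σ ↔
    e.Ok b M σ ∧ f.Ok b M σ ∧ Fits b (e.eval σ - f.eval σ) := Iff.rfl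
@[simp] theorem Expr.ok_mul : (e * f).Ok b M σ ↔
    e.Ok b M σ ∧ f.Ok b M σ ∧ Fits b (e.eval σ * f.eval σ) := Iff.rfl
@[simp] theorem Expr.ok_div : (e / f).Ok b M σ ↔
    e.Ok b M σ ∧ f.Ok b M σ ∧ Fits b (e.eval σ / f.eval σ) := Iff.rfl
@[simp] theorem Expr.ok_lt :
    (e.lt f).Ok b M σ ↔ e.Ok b M σ ∧ f.Ok b M σ ∧ 1 ≤ b := Iff.rfl
@[simp] theorem Expr.ok_eq :
    (e.eq f).Ok b M σ ↔ e.Ok b M σ ∧ f.Ok b M σ ∧ 1 ≤ b := Iff.rfl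
@[simp] theorem Expr.ok_ofNat :
    (no_index (OfNat.ofNat x) : Expr).Ok b M σ ↔ Fits b ((OfNat.ofNat x : ℕ) : ℤ) := Iff.rfl
@[simp] theorem Expr.ok_load : (Expr.load e).Ok b M σ ↔
    e.Ok b M σ ∧ 0 ≤ e.eval σ ∧ e.eval σ < M := Iff.rfl

@[simp] theorem Expr.cost_reg : (Expr.reg x).cost = 1 := rfl
@[simp] theorem Expr.cost_add : (e + f).cost = e.cost + f.cost + 1 := rfl
@[simp] theorem Expr.cost_sub : (e - f).cost = e.cost + f.cost + 1 := rfl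
@[simp] theorem Expr.cost_mul : (e * f).cost = e.cost + f.cost + 1 := rfl
@[simp] theorem Expr.cost_div : (e / f).cost = e.cost + f.cost + 1 := rfl
@[simp] theorem Expr.cost_lt : (e.lt f).cost = e.cost + f.cost + 1 := rfl
@[simp] theorem Expr.cost_eq : (e.eq f).cost = e.cost + f.cost + 1 := rfl
@[simp] theorem Expr.cost_ofNat : (no_index (OfNat.ofNat x) : Expr).cost = 1 := rfl
@[simp] theorem Expr.cost_load : (Expr.load e).cost = e.cost + 1 := rfl

end Simp

/-- The state after the assignment of `z` to the register `x`. -/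
def State.set (σ : State) (x : ℕ) (z : ℤ) : State := ⟨Function.update σ.reg x z, σ.mem⟩

/-- The state after a write of `z` to the memory cell `a`. -/
def State.put (σ : State) (a : ℕ) (z : ℤ) : State := ⟨σ.reg, Function.update σ.mem a z⟩

@[simp] theorem State.reg_set (σ : State) (x y : ℕ) (z : ℤ) :
    (σ.set x z).reg y = if y = x then z else σ.reg y := by
  simp [State.set, Function.update_apply]

@[simp] theorem State.mem_set (σ : State) (x : ℕ) (z : ℤ) : (σ.set x z).mem = σ.mem := rfl

@[simp] theorem State.reg_put (σ : State) (a : ℕ) (z : ℤ) : (σ.put a z).reg = σ.reg := rfl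

@[simp] theorem State.mem_put (σ : State) (a c : ℕ) (z : ℤ) :
    (σ.put a z).mem c = if c = a then z else σ.mem c := by
  simp [State.put, Function.update_apply]

/-- Total correctness with a time bound: started in `σ`, the program halts after at most `T` steps
in a state that satisfies `Q`. -/
def Runs (b M : ℕ) (c : Cmd) (σ : State) (T : ℕ) (Q : State → Prop) : Prop :=
  ∃ t τ, t ≤ T ∧ Exec b M c σ t τ ∧ Q τ

namespace Runs

variable {b M : ℕ} {c d : Cmd} {e f : Expr} {σ : State} {T T₁ T₂ : ℕ} {P Q : State → Prop}

theorem mono (h : Runs b M c σ T₁ P) (hT : T₁ ≤ T₂) (hPQ : ∀ τ, P τ → Q τ) :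
    Runs b M c σ T₂ Q := by
  obtain ⟨t, τ, ht, hc, hP⟩ := h
  exact ⟨t, τ, ht.trans hT, hc, hPQ τ hP⟩

theorem imp (h : Runs b M c σ T P) (hPQ : ∀ τ, P τ → Q τ) : Runs b M c σ T Q :=
  h.mono le_rfl hPQ

theorem time_le (hT : T₁ ≤ T₂) (h : Runs b M c σ T₁ P) : Runs b M c σ T₂ P :=
  h.mono hT fun _ => id

theorem seq (h : Runs b M c σ T₁ fun τ => Runs b M d τ T₂ Q) :
    Runs b M (Cmd.seq c d) σ (T₁ + T₂) Q := by
  obtain ⟨t, τ, ht, hc, t', τ', ht', hd, hQ⟩ := h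
  exact ⟨t + t', τ', by omega, .seq c d σ τ τ' t t' hc hd, hQ⟩

/-- A loop that makes exactly `m` rounds, with an invariant `I i` after `i` rounds. -/
theorem loop (I : ℕ → State → Prop) (m : ℕ) (h₀ : I 0 σ)
    (hok : ∀ i ≤ m, ∀ σ, I i σ → e.Ok b M σ)
    (hc : ∀ i < m, ∀ σ, I i σ → e.eval σ ≠ 0 ∧ Runs b M c σ T (I (i + 1)))
    (hm : ∀ σ, I m σ → e.eval σ = 0) :
    Runs b M (Cmd.while e c) σ (m * (e.cost + 1 + T) + (e.cost + 1)) (I m) := by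
  suffices H : ∀ j ≤ m, ∀ σ, I (m - j) σ →
      Runs b M (Cmd.while e c) σ (j * (e.cost + 1 + T) + (e.cost + 1)) (I m) by
    exact H m le_rfl σ (by simpa using h₀)
  intro j
  induction j with
  | zero =>
    intro _ σ hσ
    exact ⟨_, σ, by omega, .while_false e c σ (hm σ hσ ▸ (hok m le_rfl σ hσ).value_eq), hσ⟩
  | succ j ih =>
    intro hj σ hσ
    obtain ⟨hz, t, τ, ht, hc, hI⟩ := hc (m - (j + 1)) (by omega) σ hσ
    rw [show m - (j + 1) + 1 = m - j by omega] at hI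
    obtain ⟨t', τ', ht', hw, hI'⟩ := ih (by omega) τ hI
    refine ⟨_, τ', ?_, .while_true e c σ τ τ' _ t t'
      (hok _ (by omega) σ hσ).value_eq hz hc hw, hI'⟩
    have := Nat.succ_mul j (e.cost + 1 + T)
    rw [Nat.succ_eq_add_one] at this
    omega

end Runs

/-- A bound on the number of steps of a program without loops. -/
def Cmd.bound : Cmd → ℕ
  | skip => 1
  | assign _ e => e.cost + 1
  | store e f => e.cost + f.cost + 1
  | seq c d => c.bound + d.bound
  | ite e c d => e.cost + 1 + c.bound + d.bound
  | .while _ _ => 0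

/-- Total correctness, with the time bound that is read off a program without loops. -/
def Run (b M : ℕ) (c : Cmd) (σ : State) (Q : State → Prop) : Prop :=
  Runs b M c σ c.bound Q

namespace Run

variable {b M : ℕ} {c d : Cmd} {e f : Expr} {σ : State} {P Q : State → Prop}

theorem runs {T : ℕ} (h : Run b M c σ Q) (hT : c.bound ≤ T) : Runs b M c σ T Q :=
  Runs.time_le hT h

theorem imp (h : Run b M c σ P) (hPQ : ∀ τ, P τ → Q τ) : Run b M c σ Q :=
  Runs.imp h hPQ

theorem skip (h : Q σ) : Run b M Cmd.skip σ Q :=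
  ⟨1, σ, le_rfl, .skip σ, h⟩

theorem assign {x : ℕ} (z : ℤ) (hok : e.Ok b M σ) (hz : e.eval σ = z) (h : Q (σ.set x z)) :
    Run b M (Cmd.assign x e) σ Q :=
  ⟨_, _, le_rfl, .assign σ x e z (hz ▸ hok.value_eq), h⟩

theorem load {x : ℕ} (a : ℕ) (z : ℤ) (hok : e.Ok b M σ) (ha : e.eval σ = a) (haM : a < M)
    (hz : σ.mem a = z) (h : Q (σ.set x z)) : Run b M (Cmd.assign x (Expr.load e)) σ Q := by
  refine assign z ⟨hok, by omega, by omega⟩ ?_ h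
  simp [ha, hz]

theorem store (a : ℕ) (z : ℤ) (hok : e.Ok b M σ ∧ f.Ok b M σ) (ha : e.eval σ = a) (haM : a < M)
    (hz : f.eval σ = z) (h : Q (σ.put a z)) : Run b M (Cmd.store e f) σ Q :=
  ⟨_, _, le_rfl, .store σ e f a z (ha ▸ hok.1.value_eq) haM (hz ▸ hok.2.value_eq), h⟩

theorem seq (h : Run b M c σ fun τ => Run b M d τ Q) : Run b M (Cmd.seq c d) σ Q :=
  Runs.seq h

theorem ite (hok : e.Ok b M σ) (h₁ : e.eval σ ≠ 0 → Run b M c σ Q)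
    (h₂ : e.eval σ = 0 → Run b M d σ Q) : Run b M (Cmd.ite e c d) σ Q := by
  by_cases hz : e.eval σ = 0
  · obtain ⟨t, τ, ht, hc, hQ⟩ := h₂ hz
    exact ⟨_, τ, by simp only [Cmd.bound]; omega, .ite_false e c d σ τ t (hz ▸ hok.value_eq) hc, hQ⟩
  · obtain ⟨t, τ, ht, hc, hQ⟩ := h₁ hz
    exact ⟨_, τ, by simp only [Cmd.bound]; omega, .ite_true e c d σ τ _ t hok.value_eq hz hc, hQ⟩

end Run

/-! ### Tournaments and ranks -/

/-- Positive codes ordered by key, where the smaller one of two codes with equal keys comes first.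
-/
def Before (κ : ℕ → ℤ) (y x : ℕ) : Prop :=
  κ y < κ x ∨ κ y = κ x ∧ y < x

theorem Before.trans {κ : ℕ → ℤ} {x y z : ℕ} (h : Before κ x y) (h' : Before κ y z) :
    Before κ x z := by
  unfold Before at *
  omega

theorem before_or_eq_or_before (κ : ℕ → ℤ) (x y : ℕ) : Before κ x y ∨ x = y ∨ Before κ y x := by
  unfold Before
  omega

theorem Before.irrefl (κ : ℕ → ℤ) (x : ℕ) : ¬ Before κ x x := by
  unfold Before
  omega

open Classical in
/-- The first one of two codes, where the code `0` stands for the absence of an item. -/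
noncomputable def better (κ : ℕ → ℤ) (x y : ℕ) : ℕ :=
  if y = 0 then x else if x = 0 then y else if Before κ y x then y else x

/-- `x` is the first code with the property `P`, or `0` if there is none. -/
def IsBest (κ : ℕ → ℤ) (P : ℕ → Prop) (x : ℕ) : Prop :=
  (x = 0 ∧ ∀ y, ¬ P y) ∨ (x ≠ 0 ∧ P x ∧ ∀ y, P y → ¬ Before κ y x)

theorem IsBest.better {κ : ℕ → ℤ} {P Q : ℕ → Prop} {x y : ℕ} (hx : IsBest κ P x)
    (hy : IsBest κ Q y) : IsBest κ (fun z => P z ∨ Q z) (better κ x y) := by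
  unfold WLSQ.better
  rcases hy with ⟨rfl, hQ⟩ | ⟨hy0, hQy, hQ⟩
  · simpa [hQ] using hx
  rcases hx with ⟨rfl, hP⟩ | ⟨hx0, hPx, hP⟩
  · simp only [hP, hy0, if_false, if_true, false_or]
    exact .inr ⟨hy0, hQy, hQ⟩
  simp only [hx0, hy0, if_false]
  right
  split_ifs with h
  · refine ⟨hy0, .inr hQy, ?_⟩
    rintro z (hz | hz) hzy
    · exact hP z hz (hzy.trans h)
    · exact hQ z hz hzy
  · refine ⟨hx0, .inl hPx, ?_⟩
    rintro z (hz | hz) hzx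
    · exact hP z hz hzx
    · rcases before_or_eq_or_before κ x y with h' | rfl | h'
      · exact hQ z hz (hzx.trans h')
      · exact hQ z hz hzx
      · exact h h'

theorem IsBest.congr {κ : ℕ → ℤ} {P Q : ℕ → Prop} {x : ℕ} (hx : IsBest κ P x)
    (h : ∀ y, P y ↔ Q y) : IsBest κ Q x := by
  rwa [← show P = Q from funext fun y => propext (h y)]

theorem better_le {κ : ℕ → ℤ} {m x y : ℕ} (hx : x ≤ m) (hy : y ≤ m) : better κ x y ≤ m := by
  unfold better
  split_ifs <;> assumption

/-- The first one of the codes on the leaves of the complete binary tree of height `h` whose leaves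
are numbered `j * 2 ^ h, …, (j + 1) * 2 ^ h - 1`. -/
noncomputable def best (κ : ℕ → ℤ) (f : ℕ → ℕ) : ℕ → ℕ → ℕ
  | 0, j => f j
  | h + 1, j => better κ (best κ f h (2 * j)) (best κ f h (2 * j + 1))

theorem div_two_pow_succ (l h : ℕ) : l / 2 ^ (h + 1) = l / 2 ^ h / 2 := by
  rw [pow_succ, Nat.div_div_eq_div_mul]

theorem best_congr {κ : ℕ → ℤ} {f g : ℕ → ℕ} {h j : ℕ} (hfg : ∀ l, l / 2 ^ h = j → f l = g l) :
    best κ f h j = best κ g h j := by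
  induction h generalizing j with
  | zero => exact hfg j (by simp)
  | succ h ih =>
    unfold best
    rw [ih, ih]
    all_goals
      intro l hl
      exact hfg l (by rw [div_two_pow_succ]; omega)

theorem best_zero (κ : ℕ → ℤ) (h j : ℕ) : best κ (fun _ => 0) h j = 0 := by
  induction h generalizing j with
  | zero => rfl
  | succ h ih => simp [best, better, ih]

theorem best_le {κ : ℕ → ℤ} {f : ℕ → ℕ} {m : ℕ} (hf : ∀ l, f l ≤ m) (h j : ℕ) :
    best κ f h j ≤ m := by
  induction h generalizing j with
  | zero => exact hf j
  | succ h ih => exact better_le (ih _) (ih _)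

theorem isBest_best (κ : ℕ → ℤ) (f : ℕ → ℕ) (h j : ℕ) :
    IsBest κ (fun y => y ≠ 0 ∧ ∃ l, l / 2 ^ h = j ∧ f l = y) (best κ f h j) := by
  induction h generalizing j with
  | zero =>
    unfold best
    by_cases hf : f j = 0
    · left
      refine ⟨hf, ?_⟩
      rintro y ⟨hy, l, hl, rfl⟩
      simp only [pow_zero, Nat.div_one] at hl
      exact hy (hl ▸ hf)
    · right
      refine ⟨hf, ⟨hf, j, by simp, rfl⟩, ?_⟩
      rintro y ⟨hy, l, hl, rfl⟩
      simp only [pow_zero, Nat.div_one] at hl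
      exact hl ▸ Before.irrefl _ _
  | succ h ih =>
    refine ((ih (2 * j)).better (ih (2 * j + 1))).congr fun y => ?_
    constructor
    · rintro (⟨hy, l, hl, rfl⟩ | ⟨hy, l, hl, rfl⟩) <;>
        exact ⟨hy, l, by rw [div_two_pow_succ]; omega, rfl⟩
    · rintro ⟨hy, l, hl, rfl⟩
      rw [div_two_pow_succ] at hl
      by_cases h2 : l / 2 ^ h = 2 * j
      · exact .inl ⟨hy, l, h2, rfl⟩
      · exact .inr ⟨hy, l, by omega, rfl⟩

open Classical in
/-- The position, counted from `0`, of the code `x` among the codes `1, …, m`. -/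
noncomputable def rank (κ : ℕ → ℤ) (m x : ℕ) : ℕ :=
  ((Finset.Icc 1 m).filter fun y => Before κ y x).card

theorem rank_lt_rank {κ : ℕ → ℤ} {m x y : ℕ} (hx : x ∈ Finset.Icc 1 m) (h : Before κ x y) :
    rank κ m x < rank κ m y := by
  classical
  apply Finset.card_lt_card
  rw [Finset.ssubset_iff_of_subset]
  · exact ⟨x, by simpa [h] using hx, by simp [Before.irrefl]⟩
  · intro z hz
    rw [Finset.mem_filter] at hz ⊢
    exact ⟨hz.1, hz.2.trans h⟩

theorem rank_lt_iff {κ : ℕ → ℤ} {m x y : ℕ} (hx : x ∈ Finset.Icc 1 m) (hy : y ∈ Finset.Icc 1 m) :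
    rank κ m x < rank κ m y ↔ Before κ x y := by
  refine ⟨fun h => ?_, rank_lt_rank hx⟩
  rcases before_or_eq_or_before κ x y with h' | rfl | h'
  · exact h'
  · exact absurd h (lt_irrefl _)
  · exact absurd (rank_lt_rank hy h') (by omega)

theorem rank_inj {κ : ℕ → ℤ} {m x y : ℕ} (hx : x ∈ Finset.Icc 1 m) (hy : y ∈ Finset.Icc 1 m)
    (h : rank κ m x = rank κ m y) : x = y := by
  rcases before_or_eq_or_before κ x y with h' | h' | h'
  · exact absurd (rank_lt_rank hx h') (by omega)
  · exact h'
  · exact absurd (rank_lt_rank hy h') (by omega)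

theorem rank_lt {κ : ℕ → ℤ} {m x : ℕ} (hx : x ∈ Finset.Icc 1 m) : rank κ m x < m := by
  classical
  calc rank κ m x < (Finset.Icc 1 m).card := by
        apply Finset.card_lt_card
        rw [Finset.ssubset_iff_of_subset (Finset.filter_subset _ _)]
        exact ⟨x, hx, by simp [Before.irrefl]⟩
    _ = m := by simp

theorem exists_rank_eq {κ : ℕ → ℤ} {m p : ℕ} (hp : p < m) :
    ∃ x ∈ Finset.Icc 1 m, rank κ m x = p := by
  have := Finset.surj_on_of_inj_on_of_card_le (s := Finset.Icc 1 m) (t := Finset.range m)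
    (fun x _ => rank κ m x) (fun x hx => by simpa using rank_lt hx)
    (fun x y hx hy h => rank_inj hx hy h) (by simp) p (by simpa using hp)
  obtain ⟨x, hx, h⟩ := this
  exact ⟨x, hx, h.symm⟩

open Classical in
/-- If a property is inherited by earlier codes, then the codes with the property are those of the
lowest ranks. -/
theorem iff_rank_lt_card {κ : ℕ → ℤ} {m : ℕ} {P : ℕ → Prop}
    (hP : ∀ x y, Before κ y x → P x → P y) {x : ℕ} (hx : x ∈ Finset.Icc 1 m) :
    P x ↔ rank κ m x < ((Finset.Icc 1 m).filter P).card := by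
  constructor
  · intro h
    apply Finset.card_lt_card
    rw [Finset.ssubset_iff_of_subset]
    · exact ⟨x, by simpa [h] using hx, by simp [Before.irrefl]⟩
    · intro z hz
      rw [Finset.mem_filter] at hz ⊢
      exact ⟨hz.1, hP x z hz.2 h⟩
  · intro h
    by_contra hPx
    refine absurd (Finset.card_le_card ?_) (not_le.2 h)
    intro z hz
    rw [Finset.mem_filter] at hz ⊢
    refine ⟨hz.1, ?_⟩
    rcases before_or_eq_or_before κ z x with h' | rfl | h'
    · exact h'
    · exact absurd hz.2 hPx
    · exact absurd (hP z x h' hz.2) hPx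

/-- The code that remains for the root of a tournament in which the codes of the ranks below `p`
have been removed has rank `p`. -/
theorem rank_eq_of_isBest {κ : ℕ → ℤ} {m p x : ℕ} (hp : p < m)
    (hx : IsBest κ (fun y => y ∈ Finset.Icc 1 m ∧ p ≤ rank κ m y) x) :
    x ∈ Finset.Icc 1 m ∧ rank κ m x = p := by
  obtain ⟨y, hy, hyp⟩ := exists_rank_eq (κ := κ) hp
  rcases hx with ⟨-, h⟩ | ⟨-, ⟨hx, hpx⟩, h⟩
  · exact absurd ⟨hy, hyp.ge⟩ (h y)
  · refine ⟨hx, le_antisymm ?_ hpx⟩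
    by_contra! hlt
    exact h y ⟨hy, hyp.ge⟩ ((rank_lt_iff hy hx).1 (by omega))

/-! ### Records -/

/-- Sequential composition. -/
infixr:60 " ;; " => Cmd.seq

/-- `p` is the address of a record of the tree of height `h` whose leaves are numbered
`j * 2 ^ h, …, (j + 1) * 2 ^ h - 1` and hold the codes that `f` assigns to them. A record has three
words: the addresses of the two children, and the first one of the codes on the leaves. All the
records of the tree are below the address `lim`. -/
def Rep (κ : ℕ → ℤ) (f : ℕ → ℕ) (rc : ℕ → ℤ) (lim : ℕ) : ℕ → ℕ → ℕ → Prop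
  | 0, j, p => p + 3 ≤ lim ∧ rc (p + 2) = best κ f 0 j
  | h + 1, j, p => p + 3 ≤ lim ∧ rc (p + 2) = best κ f (h + 1) j ∧ ∃ l r : ℕ, rc p = l ∧
      rc (p + 1) = r ∧ Rep κ f rc lim h (2 * j) l ∧ Rep κ f rc lim h (2 * j + 1) r

namespace Rep

variable {κ κ' : ℕ → ℤ} {f g : ℕ → ℕ} {rc rc' : ℕ → ℤ} {lim lim' h j p : ℕ}

theorem le_lim (H : Rep κ f rc lim h j p) : p + 3 ≤ lim := by
  cases h <;> exact H.1

theorem val (H : Rep κ f rc lim h j p) : rc (p + 2) = best κ f h j := by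
  cases h
  · exact H.2
  · exact H.2.1

/-- Records are not affected by writes to higher addresses. -/
theorem frame (H : Rep κ f rc lim h j p) (hlim : lim ≤ lim') (hrc : ∀ a < lim, rc' a = rc a) :
    Rep κ f rc' lim' h j p := by
  induction h generalizing j p with
  | zero =>
    refine ⟨H.1.trans hlim, ?_⟩
    rw [hrc _ (by have := H.1; omega), H.2]
  | succ h ih =>
    obtain ⟨h₁, h₂, l, r, hl, hr, hL, hR⟩ := H
    refine ⟨h₁.trans hlim, ?_, l, r, ?_, ?_, ih hL, ih hR⟩
    · rw [hrc _ (by omega), h₂]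
    · rw [hrc _ (by omega), hl]
    · rw [hrc _ (by omega), hr]

theorem congr (H : Rep κ f rc lim h j p) (hfg : ∀ l, l / 2 ^ h = j → f l = g l) :
    Rep κ g rc lim h j p := by
  induction h generalizing j p with
  | zero => exact ⟨H.1, by rw [H.2, best_congr hfg]⟩
  | succ h ih =>
    obtain ⟨h₁, h₂, l, r, hl, hr, hL, hR⟩ := H
    refine ⟨h₁, by rw [h₂, best_congr hfg], l, r, hl, hr, ih hL ?_, ih hR ?_⟩ <;>
    · intro i hi
      exact hfg i (by rw [div_two_pow_succ]; omega)

/-- A tree without any code does not depend on the keys. -/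
theorem rekey (H : Rep κ (fun _ => 0) rc lim h j p) : Rep κ' (fun _ => 0) rc lim h j p := by
  induction h generalizing j p with
  | zero => exact H
  | succ h ih =>
    obtain ⟨h₁, h₂, l, r, hl, hr, hL, hR⟩ := H
    exact ⟨h₁, by rw [h₂, best_zero, best_zero], l, r, hl, hr, ih hL, ih hR⟩

/-- A record of zeros at the address `0` is its own child, and represents the trees of all heights
without any code. -/
theorem null (hlim : 3 ≤ lim) (hrc : ∀ a < 3, rc a = 0) : Rep κ (fun _ => 0) rc lim h j 0 := by
  induction h generalizing j with
  | zero => exact ⟨by omega, by simp [hrc, best]⟩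
  | succ h ih => exact
      ⟨by omega, by simp [hrc, best_zero], 0, 0, by simp [hrc], by simp [hrc], ih, ih⟩

end Rep

/-- The registers `3` and `4` hold the number of segments and the length `N` of the memory blocks,
and the input is in its place. -/
structure Base (inp : ℕ → ℤ) (n N : ℕ) (σ : State) : Prop where
  reg3 : σ.reg 3 = n
  reg4 : σ.reg 4 = N
  mem : ∀ a ≤ 4 * n, σ.mem a = inp a

/-- The expression `key r` computes the key of the code in the register `r`. -/
structure KeySpec (b M : ℕ) (inp : ℕ → ℤ) (n N : ℕ) (key : ℕ → Expr) (κ : ℕ → ℤ) (m : ℕ) :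
    Prop where
  cost_le : ∀ r, (key r).cost ≤ 30
  ok : ∀ σ r x, Base inp n N σ → σ.reg r = (x : ℕ) → 1 ≤ x → x ≤ m → (key r).Ok b M σ
  eval : ∀ σ r x, Base inp n N σ → σ.reg r = (x : ℕ) → 1 ≤ x → x ≤ m → (key r).eval σ = κ x

/-- Replaces the code in the register `a` by the one in the register `c` if the latter comes
first. -/
def pick (key : ℕ → Expr) (a c : ℕ) : Cmd :=
  .ite (.reg c)
    (.ite (.reg a)
      (.ite ((key c).lt (key a) + (key c).eq (key a) * (Expr.reg c).lt (.reg a))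
        (.assign a (.reg c)) .skip)
      (.assign a (.reg c)))
    .skip

theorem State.set_self (σ : State) (x : ℕ) : σ.set x (σ.reg x) = σ := by
  simp [State.set]

theorem fits_of_le {b : ℕ} {x y : ℤ} (hx : 0 ≤ x) (hxy : x < y) (hy : y ≤ 2 ^ b) : Fits b x := by
  unfold Fits
  omega

section

variable {b M : ℕ} {inp : ℕ → ℤ} {n N k m : ℕ} {key : ℕ → Expr} {κ : ℕ → ℤ} {σ : State}

theorem bound_pick_le (hK : KeySpec b M inp n N key κ m) (a c : ℕ) :
    (pick key a c).bound ≤ 200 := by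
  have h1 := hK.cost_le a
  have h2 := hK.cost_le c
  simp only [pick, Cmd.bound, Expr.cost_reg, Expr.cost_add, Expr.cost_mul, Expr.cost_lt,
    Expr.cost_eq]
  omega

theorem run_pick (hK : KeySpec b M inp n N key κ m) (hb : 2 ≤ b) (hσ : Base inp n N σ) {a c x y : ℕ}
    (ha : σ.reg a = x) (hc : σ.reg c = y) (hx : x ≤ m) (hy : y ≤ m) :
    Run b M (pick key a c) σ fun τ => τ = σ.set a (better κ x y) := by
  have hb4 : (2 : ℤ) ^ 2 ≤ 2 ^ b := pow_le_pow_right₀ (by norm_num) hb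
  refine Run.ite (by simp) (fun h1 => Run.ite (by simp) (fun h2 =>
    Run.ite ?_ (fun h3 => Run.assign (y : ℤ) (by simp) (by simp [hc]) ?_)
    (fun h3 => Run.skip ?_))
    (fun h2 => Run.assign (y : ℤ) (by simp) (by simp [hc]) ?_)) (fun h1 => Run.skip ?_)
  all_goals simp only [Expr.eval_reg, hc, Nat.cast_eq_zero, ne_eq] at h1
  all_goals try simp only [Expr.eval_reg, ha, Nat.cast_eq_zero, ne_eq] at h2
  · simp only [Expr.ok_add, Expr.ok_lt, Expr.ok_mul, Expr.ok_eq, Expr.ok_reg, Expr.eval_mul,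
      Expr.eval_lt, Expr.eval_eq, hK.ok σ a x hσ ha (by omega) hx, true_and,
      hK.ok σ c y hσ hc (by omega) hy]
    unfold Fits
    refine ⟨by omega, ⟨by omega, by omega, ?_⟩, ?_⟩
    · split_ifs <;> constructor <;> omega
    · split_ifs <;> constructor <;> omega
  · simp only [Expr.eval_add, Expr.eval_lt, Expr.eval_mul, Expr.eval_eq,
      hK.eval σ a x hσ ha (by omega) hx, Expr.eval_reg, ha, hc,
      hK.eval σ c y hσ hc (by omega) hy, Nat.cast_lt] at h3
    have : Before κ y x := by
      unfold Before
      by_contra! h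
      simp [not_lt.2 h.1] at h3
      exact absurd h3.1 (not_lt.2 (h.2 h3.2))
    simp [better, this, h1, h2]
  · simp only [Expr.eval_add, Expr.eval_lt, Expr.eval_mul, Expr.eval_eq,
      hK.eval σ a x hσ ha (by omega) hx, Expr.eval_reg, ha, hc,
      hK.eval σ c y hσ hc (by omega) hy, Nat.cast_lt] at h3
    have : ¬ Before κ y x := by
      rintro (h | ⟨h, h'⟩)
      · simp [h] at h3
        split_ifs at h3 <;> omega
      · simp [h, h'] at h3
    simp [better, this, h1, h2, ← ha, State.set_self]
  · simp [better, h1, h2]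
  · simp [better, h1, ← ha, State.set_self]

theorem Base.set (hσ : Base inp n N σ) {x : ℕ} {z : ℤ} (h3 : x ≠ 3) (h4 : x ≠ 4) :
    Base inp n N (σ.set x z) := by
  refine ⟨?_, ?_, hσ.mem⟩
  · simp [h3.symm, hσ.reg3]
  · simp [h4.symm, hσ.reg4]

theorem Base.put (hσ : Base inp n N σ) {a : ℕ} {z : ℤ} (ha : 4 * n < a) :
    Base inp n N (σ.put a z) := by
  refine ⟨hσ.reg3, hσ.reg4, fun c hc => ?_⟩
  rw [State.mem_put, if_neg (by omega), hσ.mem c hc]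

theorem Base.of_eq (hσ : Base inp n N σ) {τ : State} (h3 : τ.reg 3 = σ.reg 3)
    (h4 : τ.reg 4 = σ.reg 4) (hm : ∀ a ≤ 4 * n, τ.mem a = σ.mem a) : Base inp n N τ :=
  ⟨h3.trans hσ.reg3, h4.trans hσ.reg4, fun a ha => (hm a ha).trans (hσ.mem a ha)⟩

end

/-! ### Updating a path -/

/-- The memory holds a complete binary tree of height `k` with the codes `f` on its `N` leaves: the
cell `2 * N + i` holds the address of the record for the `i`-th node in heap order. Addresses of
records are relative to `9 * N`, and the next free one is `lim`, in register `5`. -/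
structure Tree (κ : ℕ → ℤ) (f : ℕ → ℕ) (N k lim : ℕ) (σ : State) : Prop where
  reg5 : σ.reg 5 = lim
  node : ∀ h ≤ k, ∀ j < 2 ^ (k - h), ∃ p : ℕ, σ.mem (2 * N + (2 ^ (k - h) + j)) = p ∧
    Rep κ f (fun a => σ.mem (9 * N + a)) lim h j p

/-- Makes a new record for the inner node in register `6`, and moves on to its parent. -/
def pathStep (key : ℕ → Expr) : Cmd :=
  .assign 8 (.load (2 * .reg 4 + 2 * .reg 6)) ;;
  .assign 9 (.load (2 * .reg 4 + 2 * .reg 6 + 1)) ;;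
  .assign 10 (.load (9 * .reg 4 + .reg 8 + 2)) ;;
  .assign 11 (.load (9 * .reg 4 + .reg 9 + 2)) ;;
  pick key 10 11 ;;
  .store (9 * .reg 4 + .reg 5) (.reg 8) ;;
  .store (9 * .reg 4 + .reg 5 + 1) (.reg 9) ;;
  .store (9 * .reg 4 + .reg 5 + 2) (.reg 10) ;;
  .store (2 * .reg 4 + .reg 6) (.reg 5) ;;
  .assign 5 (.reg 5 + 3) ;;
  .assign 6 (.reg 6 / 2)

/-- Makes a new record for the leaf in register `6`, which gets the code in register `7`, and moves
on to its parent. -/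
def leafStep : Cmd :=
  .store (9 * .reg 4 + .reg 5 + 2) (.reg 7) ;;
  .store (2 * .reg 4 + .reg 6) (.reg 5) ;;
  .assign 5 (.reg 5 + 3) ;;
  .assign 6 (.reg 6 / 2)

/-- Puts the code in register `7` on the leaf in register `6`. All the nodes on the path from the
leaf to the root get new records, and the old records remain as they are. -/
def update (key : ℕ → Expr) : Cmd :=
  leafStep ;; .while (.reg 6) (pathStep key)

section

variable {b M : ℕ} {inp : ℕ → ℤ} {n N k m : ℕ} {key : ℕ → Expr} {κ : ℕ → ℤ} {σ : State}

theorem run_pathStep (hK : KeySpec b M inp n N key κ m) (hb : 2 ≤ b) (hM : (M : ℤ) ≤ 2 ^ b)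
    (hσ : Base inp n N σ) (hnN : 2 * n < N) {u lim l r x y : ℕ} (hu : u < N)
    (h6 : σ.reg 6 = u) (h5 : σ.reg 5 = lim) (hl : σ.mem (2 * N + 2 * u) = l)
    (hr : σ.mem (2 * N + (2 * u + 1)) = r) (hlM : l + 3 ≤ lim) (hrM : r + 3 ≤ lim)
    (hM' : 9 * N + lim + 3 ≤ M)
    (hx : σ.mem (9 * N + (l + 2)) = x) (hy : σ.mem (9 * N + (r + 2)) = y) (hxm : x ≤ m)
    (hym : y ≤ m) :
    Run b M (pathStep key) σ fun τ =>
      (∀ i, i < 5 ∨ i = 7 ∨ 11 < i → τ.reg i = σ.reg i) ∧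
      τ.reg 5 = (lim + 3 : ℕ) ∧ τ.reg 6 = (u / 2 : ℕ) ∧
      (∀ a, a < 9 * N + lim → a ≠ 2 * N + u → τ.mem a = σ.mem a) ∧
      τ.mem (2 * N + u) = lim ∧ τ.mem (9 * N + lim) = l ∧ τ.mem (9 * N + (lim + 1)) = r ∧
      τ.mem (9 * N + (lim + 2)) = better κ x y := by
  have h4 := hσ.reg4
  have hz := better_le (κ := κ) hxm hym
  refine Run.seq <| Run.load (2 * N + 2 * u) l ?_ ?_ ?_ hl <|
    Run.seq <| Run.load (2 * N + (2 * u + 1)) r ?_ ?_ ?_ hr <|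
    Run.seq <| Run.load (9 * N + (l + 2)) x ?_ ?_ ?_ hx <|
    Run.seq <| Run.load (9 * N + (r + 2)) y ?_ ?_ ?_ hy <|
    Run.seq <| (run_pick hK hb ((((hσ.set ?_ ?_).set ?_ ?_).set ?_ ?_).set ?_ ?_) (x := x) (y := y)
      ?_ ?_ hxm hym).imp ?_
  rotate_left 22
  · rintro _ rfl
    refine Run.seq <| Run.store (9 * N + lim) l ?_ ?_ ?_ ?_ <|
      Run.seq <| Run.store (9 * N + (lim + 1)) r ?_ ?_ ?_ ?_ <|
      Run.seq <| Run.store (9 * N + (lim + 2)) (better κ x y : ℕ) ?_ ?_ ?_ ?_ <|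
      Run.seq <| Run.store (2 * N + u) lim ?_ ?_ ?_ ?_ <|
      Run.seq <| Run.assign (lim + 3 : ℕ) ?_ ?_ <| Run.assign (u / 2 : ℕ) ?_ ?_ ?_
    rotate_left 20
    · refine ⟨?_, ?_, ?_, ?_, ?_, ?_, ?_, ?_⟩
      · intro i hi
        simp [show i ≠ 5 by omega, show i ≠ 6 by omega, show i ≠ 8 by omega, show i ≠ 9 by omega,
          show i ≠ 10 by omega, show i ≠ 11 by omega]
      · simp
      · simp
      · intro a ha ha'
        simp [ha', show a ≠ 9 * N + lim by omega, show a ≠ 9 * N + (lim + 1) by omega,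
          show a ≠ 9 * N + (lim + 2) by omega]
      · simp
      · simp [show 9 * N + lim ≠ 2 * N + u by omega]
      · simp [show 9 * N + (lim + 1) ≠ 2 * N + u by omega]
      · simp [show 9 * N + (lim + 2) ≠ 2 * N + u by omega]
    all_goals
      try simp [h4, h5, h6]
      try unfold Fits
      try omega
  all_goals
    try simp [h4, h6]
    try unfold Fits
    try omega

theorem bound_pathStep_le (hK : KeySpec b M inp n N key κ m) : (pathStep key).bound ≤ 400 := by
  have := bound_pick_le hK 10 11
  simp only [pathStep, Cmd.bound, Expr.cost_reg, Expr.cost_add, Expr.cost_mul, Expr.cost_div,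
    Expr.cost_ofNat, Expr.cost_load]
  omega

theorem two_pow_add_div {l : ℕ} (hl : l < 2 ^ k) {h : ℕ} (hk : h ≤ k) :
    (2 ^ k + l) / 2 ^ h = 2 ^ (k - h) + l / 2 ^ h ∧ l / 2 ^ h < 2 ^ (k - h) := by
  have hpow : 2 ^ k = 2 ^ h * 2 ^ (k - h) := by rw [← pow_add]; congr 1; omega
  constructor
  · rw [hpow, Nat.mul_add_div (by positivity)]
  · rwa [Nat.div_lt_iff_lt_mul (by positivity), mul_comm, ← hpow]

theorem two_pow_add_inj {a c i j : ℕ} (hi : i < 2 ^ a) (hj : j < 2 ^ c)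
    (h : 2 ^ a + i = 2 ^ c + j) : a = c ∧ i = j := by
  have ha : Nat.log 2 (2 ^ a + i) = a :=
    Nat.log_eq_of_pow_le_of_lt_pow (by omega) (by rw [pow_succ]; omega)
  have hc : Nat.log 2 (2 ^ c + j) = c :=
    Nat.log_eq_of_pow_le_of_lt_pow (by omega) (by rw [pow_succ]; omega)
  rw [h, hc] at ha
  subst ha
  exact ⟨rfl, by omega⟩

/-- The state in the course of an update of the leaf `l`, when the path has got new records up to
the height `i`, the last one of them at the address `lim - 3`. -/
structure PathInv (κ : ℕ → ℤ) (f : ℕ → ℕ) (inp : ℕ → ℤ) (n N k l lim₀ : ℕ) (σ₀ : State) (i : ℕ)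
    (σ : State) : Prop where
  base : Base inp n N σ
  reg5 : σ.reg 5 = (lim₀ + 3 * (i + 1) : ℕ)
  reg6 : σ.reg 6 = ((N + l) / 2 ^ (i + 1) : ℕ)
  reg : ∀ x, x < 5 ∨ x = 7 ∨ 11 < x → σ.reg x = σ₀.reg x
  mem : ∀ a, a < 2 * N ∨ 4 * N ≤ a ∧ a < 9 * N + lim₀ → σ.mem a = σ₀.mem a
  node : ∀ h ≤ k, ∀ j < 2 ^ (k - h), h ≤ i ∨ l / 2 ^ h ≠ j →
    ∃ p : ℕ, σ.mem (2 * N + (2 ^ (k - h) + j)) = p ∧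
      Rep κ f (fun a => σ.mem (9 * N + a)) (lim₀ + 3 * (i + 1)) h j p

theorem PathInv.runs_pathStep {f : ℕ → ℕ} {l lim₀ i : ℕ} {σ₀ : State}
    (hK : KeySpec b M inp n N key κ m) (hb : 2 ≤ b) (hM : (M : ℤ) ≤ 2 ^ b) (hN : N = 2 ^ k)
    (hnN : 2 * n < N) (hl : l < N) (hf : ∀ l, f l ≤ m) (hM' : 9 * N + lim₀ + 3 * (k + 1) ≤ M)
    (hi : i < k) (H : PathInv κ f inp n N k l lim₀ σ₀ i σ) :
    Runs b M (pathStep key) σ 400 (PathInv κ f inp n N k l lim₀ σ₀ (i + 1)) := by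
  set j := l / 2 ^ (i + 1) with hj
  obtain ⟨hu, hjk⟩ := two_pow_add_div (hN ▸ hl) (show i + 1 ≤ k by omega)
  obtain ⟨u, hudef⟩ : ∃ u, (N + l) / 2 ^ (i + 1) = u := ⟨_, rfl⟩
  rw [← hN, ← hj, hudef] at hu
  have hpow : 2 ^ (k - i) = 2 * 2 ^ (k - (i + 1)) := by rw [← pow_succ']; congr 1; omega
  have hpowN : 2 ^ (k - i) ≤ N := hN ▸ Nat.pow_le_pow_right (by norm_num) (by omega)
  obtain ⟨p, hp, hP⟩ := H.node i hi.le (2 * j) (by omega) (.inl le_rfl)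
  obtain ⟨q, hq, hQ⟩ := H.node i hi.le (2 * j + 1) (by omega) (.inl le_rfl)
  have hplim := hP.le_lim
  have hqlim := hQ.le_lim
  refine ((run_pathStep hK hb hM H.base hnN (u := u) (by omega) (hudef ▸ H.reg6) H.reg5
    (l := p) (r := q) ?_ ?_ (by omega) (by omega) (by omega) hP.val hQ.val (best_le hf _ _)
    (best_le hf _ _)).runs (bound_pathStep_le hK)).imp ?_
  · rw [hu, ← hp, hpow]; congr 1; ring
  · rw [hu, ← hq, hpow]; congr 1; ring
  rintro τ ⟨hreg, h5, h6, hmem, hcur, hrc0, hrc1, hrc2⟩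
  have hframe : ∀ a < lim₀ + 3 * (i + 1), τ.mem (9 * N + a) = σ.mem (9 * N + a) := fun a ha =>
    hmem _ (by omega) (by omega)
  refine ⟨?_, ?_, ?_, ?_, ?_, ?_⟩
  · exact H.base.of_eq (hreg 3 (by omega)) (hreg 4 (by omega)) fun a ha =>
      hmem a (by omega) (by omega)
  · rw [h5]; push_cast; ring
  · rw [h6, ← hudef, ← div_two_pow_succ]
  · intro x hx
    rw [hreg x hx, H.reg x hx]
  · intro a ha
    rw [hmem a (by omega) (by omega), H.mem a ha]
  · intro h hh c hc hic
    by_cases hnew : h = i + 1 ∧ c = j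
    · obtain ⟨rfl, rfl⟩ := hnew
      refine ⟨lim₀ + 3 * (i + 1), by rw [← hu, hcur], by omega, hrc2, p, q, hrc0, hrc1,
        hP.frame (by omega) hframe, hQ.frame (by omega) hframe⟩
    · have hold : h ≤ i ∨ l / 2 ^ h ≠ c := by
        by_cases h' : h = i + 1
        · subst h'; right; omega
        · omega
      have hne : 2 ^ (k - h) + c ≠ u := by
        rw [hu]
        intro heq
        apply hnew
        obtain ⟨hki, rfl⟩ := two_pow_add_inj hc hjk heq
        exact ⟨by omega, rfl⟩
      have hcN : 2 ^ (k - h) ≤ N := hN ▸ Nat.pow_le_pow_right (by norm_num) (by omega)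
      obtain ⟨p', hp', hP'⟩ := H.node h hh c hc hold
      exact ⟨p', by rw [hmem _ (by omega) (by omega), hp'], hP'.frame (by omega) hframe⟩

/-- An update takes time proportional to the height of the tree, and uses `k + 1` new records. -/
theorem runs_update {f : ℕ → ℕ} {l lim x : ℕ} (hK : KeySpec b M inp n N key κ m) (hb : 2 ≤ b)
    (hM : (M : ℤ) ≤ 2 ^ b) (hN : N = 2 ^ k) (hnN : 2 * n < N) (hl : l < N) (hf : ∀ l, f l ≤ m)
    (hx : x ≤ m) (hM' : 9 * N + lim + 3 * (k + 1) ≤ M) (hσ : Base inp n N σ)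
    (hT : Tree κ f N k lim σ) (h6 : σ.reg 6 = (N + l : ℕ)) (h7 : σ.reg 7 = x) :
    Runs b M (update key) σ (402 * k + 100) fun τ =>
      Base inp n N τ ∧ Tree κ (Function.update f l x) N k (lim + 3 * (k + 1)) τ ∧
      (∀ x, x < 5 ∨ 11 < x → τ.reg x = σ.reg x) ∧
      ∀ a, a < 2 * N ∨ 4 * N ≤ a ∧ a < 9 * N + lim → τ.mem a = σ.mem a := by
  have h4 := hσ.reg4
  have h5 := hT.reg5
  have hg : ∀ i, Function.update f l x i ≤ m := by
    intro i
    rw [Function.update_apply]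
    split_ifs
    exacts [hx, hf i]
  have hpre : Run b M leafStep σ
      (PathInv κ (Function.update f l x) inp n N k l lim σ 0) := by
    refine Run.seq <| Run.store (9 * N + (lim + 2)) x ?_ ?_ ?_ ?_ <|
      Run.seq <| Run.store (2 * N + (N + l)) lim ?_ ?_ ?_ ?_ <|
      Run.seq <| Run.assign (lim + 3 : ℕ) ?_ ?_ <| Run.assign ((N + l) / 2 : ℕ) ?_ ?_ ?_
    rotate_left 12
    · refine ⟨?_, ?_, ?_, ?_, ?_, ?_⟩
      · exact (((hσ.put (by omega)).put (by omega)).set (by omega) (by omega)).set (by omega)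
          (by omega)
      · simp
      · simp
      · intro y hy
        simp [show y ≠ 5 by omega, show y ≠ 6 by omega]
      · intro a ha
        simp [show a ≠ 2 * N + (N + l) by omega, show a ≠ 9 * N + (lim + 2) by omega]
      · intro h hh j hj hhj
        have hcN : 2 ^ (k - h) ≤ N := hN ▸ Nat.pow_le_pow_right (by norm_num) (by omega)
        by_cases hnew : h = 0 ∧ l = j
        · obtain ⟨rfl, rfl⟩ := hnew
          refine ⟨lim, by simp [hN], by omega, ?_⟩
          simp [best, show 9 * N + (lim + 2) ≠ 2 * N + (N + l) by omega]
        · have hne : 2 ^ (k - h) + j ≠ N + l := by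
            intro heq
            apply hnew
            obtain ⟨hkh, rfl⟩ := two_pow_add_inj hj (hN ▸ hl) (hN ▸ heq)
            exact ⟨by omega, rfl⟩
          have hlj : l / 2 ^ h ≠ j := by
            rcases hhj with h' | h'
            · obtain rfl : h = 0 := by omega
              simpa using hnew
            · exact h'
          obtain ⟨p, hp, hP⟩ := hT.node h hh j hj
          refine ⟨p, ?_, (hP.frame (by omega) ?_).congr ?_⟩
          · simp [hp, hne, show 2 * N + (2 ^ (k - h) + j) ≠ 9 * N + (lim + 2) by omega]
          · intro a ha
            simp [show 9 * N + a ≠ 2 * N + (N + l) by omega, show a ≠ lim + 2 by omega]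
          · intro i hi
            rw [Function.update_of_ne]
            rintro rfl
            exact hlj hi
    all_goals
      try simp [h4, h5, h6, h7]
      try unfold Fits
      try omega
  have hloop : ∀ τ, PathInv κ (Function.update f l x) inp n N k l lim σ 0 τ →
      Runs b M (.while (.reg 6) (pathStep key)) τ (k * (1 + 1 + 400) + (1 + 1))
        (PathInv κ (Function.update f l x) inp n N k l lim σ k) := by
    intro τ hτ
    refine Runs.loop _ k hτ (by simp) (fun i hi τ hτ => ⟨?_, ?_⟩) ?_
    · have := (two_pow_add_div (hN ▸ hl) (show i + 1 ≤ k by omega)).1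
      rw [Expr.eval_reg, hτ.reg6, hN, this, Nat.cast_ne_zero]
      positivity
    · exact hτ.runs_pathStep hK hb hM hN hnN hl hg hM' hi
    · intro τ hτ
      rw [Expr.eval_reg, hτ.reg6, Nat.div_eq_of_lt (by rw [pow_succ]; omega), Nat.cast_zero]
  refine Runs.mono (Runs.seq (hpre.imp hloop)) ?_ ?_
  · simp only [leafStep, Cmd.bound, Expr.cost_reg, Expr.cost_add, Expr.cost_mul, Expr.cost_div,
      Expr.cost_ofNat]
    omega
  · intro τ hτ
    refine ⟨hτ.base, ⟨hτ.reg5, fun h hh j hj => hτ.node h hh j hj (.inl hh)⟩, ?_, hτ.mem⟩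
    intro y hy
    exact hτ.reg y (by omega)

end

/-! ### Tournament sort -/

/-- Prepares the insertion of the next code. -/
def nextCode : Cmd :=
  .assign 13 (.reg 13 + 1) ;;
  .assign 6 (.reg 4 + .reg 13) ;;
  .assign 7 (.reg 13)

/-- Puts the codes `1, …, m` on the leaves with the same numbers, where register `12` holds `m`. -/
def insertAll (key : ℕ → Expr) : Cmd :=
  .while ((Expr.reg 13).lt (.reg 12)) (nextCode ;; update key)

/-- Takes the first code from the root, and records it and its rank. -/
def takeFirst : Cmd :=
  .assign 14 (.load (2 * .reg 4 + 1)) ;;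
  .assign 14 (.load (9 * .reg 4 + .reg 14 + 2)) ;;
  .store (.reg 15 + .reg 13) (.reg 14) ;;
  .store (.reg 15 + .reg 4 + .reg 14) (.reg 13) ;;
  .assign 6 (.reg 4 + .reg 14) ;;
  .assign 7 0 ;;
  .assign 13 (.reg 13 + 1)

/-- Takes the codes from the tree one by one, in their order. -/
def extractAll (key : ℕ → Expr) : Cmd :=
  .while ((Expr.reg 13).lt (.reg 12)) (takeFirst ;; update key)

/-- Tournament sort of the codes `1, …, m`, where register `12` holds `m`, and register `15` the
address for the output. -/
def sort (key : ℕ → Expr) : Cmd :=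
  .assign 13 0 ;; insertAll key ;; .assign 13 0 ;; extractAll key

section

variable {b M : ℕ} {inp : ℕ → ℤ} {n N k m : ℕ} {key : ℕ → Expr} {κ : ℕ → ℤ} {σ : State}

/-- The state after the insertion of the codes `1, …, i`. -/
structure InsertInv (κ : ℕ → ℤ) (inp : ℕ → ℤ) (n N k m lim B : ℕ) (σ₀ : State) (i : ℕ)
    (σ : State) : Prop where
  base : Base inp n N σ
  tree : Tree κ (fun l => if 1 ≤ l ∧ l ≤ i then l else 0) N k (lim + i * (3 * (k + 1))) σ
  reg12 : σ.reg 12 = m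
  reg13 : σ.reg 13 = i
  reg15 : σ.reg 15 = B
  mem : ∀ a, a < 2 * N ∨ 4 * N ≤ a ∧ a < 9 * N + lim → σ.mem a = σ₀.mem a

theorem Tree.set {f : ℕ → ℕ} {lim x : ℕ} {z : ℤ} (hT : Tree κ f N k lim σ) (hx : x ≠ 5) :
    Tree κ f N k lim (σ.set x z) :=
  ⟨by simpa [hx.symm] using hT.reg5, hT.node⟩

theorem Tree.rekey {κ' : ℕ → ℤ} {lim : ℕ} (hT : Tree κ (fun _ => 0) N k lim σ) :
    Tree κ' (fun _ => 0) N k lim σ :=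
  ⟨hT.reg5, fun h hh j hj => (hT.node h hh j hj).imp fun _ hp => ⟨hp.1, hp.2.rekey⟩⟩

theorem Tree.put {f : ℕ → ℕ} {lim a : ℕ} {z : ℤ} (hT : Tree κ f N k lim σ) (hN : N = 2 ^ k)
    (ha : a < 2 * N ∨ 4 * N ≤ a ∧ a < 9 * N) : Tree κ f N k lim (σ.put a z) := by
  refine ⟨hT.reg5, fun h hh j hj => ?_⟩
  have hcN : 2 ^ (k - h) ≤ N := hN ▸ Nat.pow_le_pow_right (by norm_num) (by omega)
  obtain ⟨p, hp, hP⟩ := hT.node h hh j hj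
  refine ⟨p, ?_, hP.frame le_rfl ?_⟩
  · simp [hp, show 2 * N + (2 ^ (k - h) + j) ≠ a by omega]
  · intro c _
    simp [show 9 * N + c ≠ a by omega]

theorem Tree.root {f : ℕ → ℕ} {lim : ℕ} (hT : Tree κ f N k lim σ) :
    ∃ p : ℕ, σ.mem (2 * N + 1) = p ∧ Rep κ f (fun a => σ.mem (9 * N + a)) lim k 0 p := by
  obtain ⟨p, hp, hP⟩ := hT.node k le_rfl 0 (by simp)
  exact ⟨p, by simpa using hp, hP⟩

theorem InsertInv.step {lim B i : ℕ} {σ₀ : State}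
    (hK : KeySpec b M inp n N key κ m) (hb : 2 ≤ b) (hM : (M : ℤ) ≤ 2 ^ b) (hN : N = 2 ^ k)
    (hnN : 2 * n < N) (hmN : m < N) (hM' : 9 * N + lim + m * (3 * (k + 1)) ≤ M) (hi : i < m)
    (H : InsertInv κ inp n N k m lim B σ₀ i σ) :
    Runs b M (nextCode ;; update key) σ (402 * k + 120)
      (InsertInv κ inp n N k m lim B σ₀ (i + 1)) := by
  have h4 := H.base.reg4
  have h13 := H.reg13
  have hd : (i + 1) * (3 * (k + 1)) = i * (3 * (k + 1)) + 3 * (k + 1) := by ring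
  have hdm : (i + 1) * (3 * (k + 1)) ≤ m * (3 * (k + 1)) := Nat.mul_le_mul_right _ hi
  have hpre : Run b M nextCode σ fun τ =>
      τ = ((σ.set 13 (i + 1 : ℕ)).set 6 (N + (i + 1) : ℕ)).set 7 (i + 1 : ℕ) := by
    refine Run.seq <| Run.assign (i + 1 : ℕ) ?_ ?_ <| Run.seq <|
      Run.assign (N + (i + 1) : ℕ) ?_ ?_ <| Run.assign (i + 1 : ℕ) ?_ ?_ rfl
    all_goals
      try simp [h4, h13]
      try unfold Fits
      try omega
  refine Runs.time_le ?_ (Runs.seq (hpre.imp ?_)) (T₁ := nextCode.bound + (402 * k + 100))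
  · have : nextCode.bound ≤ 20 := by decide
    omega
  rintro _ rfl
  refine (runs_update hK hb hM hN hnN (l := i + 1) (x := i + 1) (by omega) ?_ (by omega)
    (lim := lim + i * (3 * (k + 1))) (by omega)
    (((H.base.set ?_ ?_).set ?_ ?_).set ?_ ?_) (((H.tree.set ?_).set ?_).set ?_) ?_ ?_).imp ?_
  rotate_right
  · rintro τ ⟨hB, hT, hreg, hmem⟩
    refine ⟨hB, ?_, ?_, ?_, ?_, ?_⟩
    · convert hT using 1
      · funext l
        simp only [Function.update_apply]
        split_ifs <;> omega
      · omega
    · rw [hreg 12 (by omega)]; simpa using H.reg12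
    · rw [hreg 13 (by omega)]; simp
    · rw [hreg 15 (by omega)]; simpa using H.reg15
    · intro a ha
      rw [hmem a (by omega)]
      exact H.mem a ha
  · intro l
    split_ifs <;> omega
  all_goals simp

/-- The state after the extraction of the codes of the ranks below `i`. The order is at the address
`B`, and the ranks are at `B + N`. -/
structure ExtractInv (κ : ℕ → ℤ) (inp : ℕ → ℤ) (n N k m lim B : ℕ) (σ₀ : State) (i : ℕ)
    (σ : State) : Prop where
  base : Base inp n N σ
  tree : Tree κ (fun l => if l ∈ Finset.Icc 1 m ∧ i ≤ rank κ m l then l else 0) N k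
    (lim + i * (3 * (k + 1))) σ
  reg12 : σ.reg 12 = m
  reg13 : σ.reg 13 = i
  reg15 : σ.reg 15 = B
  mem : ∀ a, a < 2 * N ∨ 4 * N ≤ a ∧ a < 9 * N + lim → a < B ∨ B + 2 * N ≤ a → σ.mem a = σ₀.mem a
  sorted : ∀ x ∈ Finset.Icc 1 m, rank κ m x < i →
    σ.mem (B + rank κ m x) = x ∧ σ.mem (B + N + x) = rank κ m x

theorem ExtractInv.step {lim B i : ℕ} {σ₀ : State}
    (hK : KeySpec b M inp n N key κ m) (hb : 2 ≤ b) (hM : (M : ℤ) ≤ 2 ^ b) (hN : N = 2 ^ k)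
    (hnN : 2 * n < N) (hmN : m < N) (hB₁ : 4 * N ≤ B) (hB₂ : B + 2 * N ≤ 9 * N)
    (hM' : 9 * N + lim + m * (3 * (k + 1)) ≤ M) (hi : i < m)
    (H : ExtractInv κ inp n N k m lim B σ₀ i σ) :
    Runs b M (takeFirst ;; update key) σ (402 * k + 150)
      (ExtractInv κ inp n N k m lim B σ₀ (i + 1)) := by
  have h4 := H.base.reg4
  have h13 := H.reg13
  have h15 := H.reg15
  have hd : (i + 1) * (3 * (k + 1)) = i * (3 * (k + 1)) + 3 * (k + 1) := by ring
  have hdm : (i + 1) * (3 * (k + 1)) ≤ m * (3 * (k + 1)) := Nat.mul_le_mul_right _ hi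
  obtain ⟨p, hp, hP⟩ := H.tree.root
  have hplim := hP.le_lim
  set f : ℕ → ℕ := fun l => if l ∈ Finset.Icc 1 m ∧ i ≤ rank κ m l then l else 0 with hf
  obtain ⟨x, hx⟩ : ∃ x, x = best κ f k 0 := ⟨_, rfl⟩
  obtain ⟨hxm, hxi⟩ : x ∈ Finset.Icc 1 m ∧ rank κ m x = i := by
    refine rank_eq_of_isBest hi ((hx ▸ isBest_best κ f k 0).congr fun y => ?_)
    constructor
    · rintro ⟨hy, l, hl, rfl⟩
      simp only [hf] at hy ⊢
      split_ifs at hy ⊢ with h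
      · exact h
      · exact absurd rfl hy
    · intro hy
      have hym := Finset.mem_Icc.1 hy.1
      exact ⟨by omega, y, Nat.div_eq_of_lt (by omega), if_pos hy⟩
  have hpx : σ.mem (9 * N + (p + 2)) = x := hx ▸ hP.val
  have hx1 := Finset.mem_Icc.1 hxm
  have hpre : Run b M takeFirst σ fun τ => τ = ((((((σ.set 14 p).set 14 x).put (B + i) x).put
      (B + N + x) i).set 6 (N + x : ℕ)).set 7 (0 : ℕ)).set 13 (i + 1 : ℕ) := by
    refine Run.seq <| Run.load (2 * N + 1) p ?_ ?_ ?_ hp <|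
      Run.seq <| Run.load (9 * N + (p + 2)) x ?_ ?_ ?_ hpx <|
      Run.seq <| Run.store (B + i) x ?_ ?_ ?_ ?_ <|
      Run.seq <| Run.store (B + N + x) i ?_ ?_ ?_ ?_ <|
      Run.seq <| Run.assign (N + x : ℕ) ?_ ?_ <|
      Run.seq <| Run.assign (0 : ℕ) ?_ ?_ <| Run.assign (i + 1 : ℕ) ?_ ?_ rfl
    all_goals
      try simp [h4, h13, h15]
      try unfold Fits
      try omega
  refine Runs.time_le ?_ (Runs.seq (hpre.imp ?_)) (T₁ := takeFirst.bound + (402 * k + 100))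
  · have : takeFirst.bound ≤ 50 := by decide
    omega
  rintro _ rfl
  refine (runs_update hK hb hM hN hnN (l := x) (x := 0) (f := f) (by omega) ?_ (by omega)
    (lim := lim + i * (3 * (k + 1))) (by omega) ?_ ?_ ?_ ?_).imp ?_
  rotate_right
  · rintro τ ⟨hBase, hT, hreg, hmem⟩
    refine ⟨hBase, ?_, ?_, ?_, ?_, ?_, ?_⟩
    · convert hT using 1
      · funext l
        simp only [Function.update_apply, hf]
        by_cases hl : l ∈ Finset.Icc 1 m
        · by_cases hlx : l = x
          · subst hlx
            simp [hxi]
          · have : rank κ m l ≠ i := fun h => hlx (rank_inj hl hxm (h.trans hxi.symm))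
            simp only [hl, hlx, true_and, if_false]
            split_ifs <;> omega
        · simp [hl]
      · omega
    · rw [hreg 12 (by omega)]; simpa using H.reg12
    · rw [hreg 13 (by omega)]; simp
    · rw [hreg 15 (by omega)]; simpa using H.reg15
    · intro a ha haB
      rw [hmem a (by omega)]
      simp [show a ≠ B + i by omega, show a ≠ B + N + x by omega, H.mem a ha haB]
    · intro y hy hyi
      have hy1 := Finset.mem_Icc.1 hy
      have hyr := rank_lt (κ := κ) hy
      rw [hmem _ (by omega), hmem _ (by omega)]
      by_cases hyx : y = x
      · subst hyx
        simp [hxi, show B + i ≠ B + N + y by omega]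
      · have : rank κ m y ≠ i := fun h => hyx (rank_inj hy hxm (h.trans hxi.symm))
        obtain ⟨h1, h2⟩ := H.sorted y hy (by omega)
        simp [h1, h2, hyx, this, show B + rank κ m y ≠ B + N + x by omega,
          show B + N + y ≠ B + i by omega]
  · intro l
    simp only [hf, Finset.mem_Icc]
    split_ifs <;> omega
  · exact ((((((H.base.set (by simp) (by simp)).set (by simp) (by simp)).put (by omega)).put
      (by omega)).set (by simp) (by simp)).set (by simp) (by simp)).set (by simp) (by simp)
  · exact ((((((H.tree.set (by simp)).set (by simp)).put hN (by omega)).put hN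
      (by omega)).set (by simp)).set (by simp)).set (by simp)
  all_goals simp

/-- Sorting takes time proportional to `m * (k + 1)`. The tree, which has to be empty before, is
empty again afterwards. -/
theorem runs_sort {lim B : ℕ} (hK : KeySpec b M inp n N key κ m) (hb : 2 ≤ b)
    (hM : (M : ℤ) ≤ 2 ^ b) (hN : N = 2 ^ k) (hnN : 2 * n < N) (hmN : m < N) (hB₁ : 4 * N ≤ B)
    (hB₂ : B + 2 * N ≤ 9 * N) (hM' : 9 * N + lim + 2 * (m * (3 * (k + 1))) ≤ M)
    (hσ : Base inp n N σ) (hT : Tree κ (fun _ => 0) N k lim σ) (h12 : σ.reg 12 = m)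
    (h15 : σ.reg 15 = B) :
    Runs b M (sort key) σ (900 * (m * (k + 1)) + 100) fun τ =>
      Base inp n N τ ∧ Tree κ (fun _ => 0) N k (lim + 2 * (m * (3 * (k + 1)))) τ ∧
      (∀ a, a < 2 * N ∨ 4 * N ≤ a ∧ a < 9 * N + lim → a < B ∨ B + 2 * N ≤ a →
        τ.mem a = σ.mem a) ∧
      ∀ x ∈ Finset.Icc 1 m, τ.mem (B + rank κ m x) = x ∧ τ.mem (B + N + x) = rank κ m x := by
  have hins : ∀ τ, InsertInv κ inp n N k m lim B σ 0 τ → Runs b M (insertAll key) τ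
      (m * (3 + 1 + (402 * k + 120)) + (3 + 1)) (InsertInv κ inp n N k m lim B σ m) := by
    intro τ hτ
    refine Runs.loop _ m hτ (fun i hi τ hτ => by simp; omega) (fun i hi τ hτ => ⟨?_, ?_⟩)
      fun τ hτ => by simp [hτ.reg12, hτ.reg13]
    · simp [hτ.reg12, hτ.reg13, hi]
    · exact hτ.step hK hb hM hN hnN hmN (by omega) hi
  have hext : ∀ σ₀ τ, ExtractInv κ inp n N k m (lim + m * (3 * (k + 1))) B σ₀ 0 τ →
      Runs b M (extractAll key) τ (m * (3 + 1 + (402 * k + 150)) + (3 + 1))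
      (ExtractInv κ inp n N k m (lim + m * (3 * (k + 1))) B σ₀ m) := by
    intro σ₀ τ hτ
    refine Runs.loop _ m hτ (fun i hi τ hτ => by simp; omega) (fun i hi τ hτ => ⟨?_, ?_⟩)
      fun τ hτ => by simp [hτ.reg12, hτ.reg13]
    · simp [hτ.reg12, hτ.reg13, hi]
    · exact hτ.step hK hb hM hN hnN hmN hB₁ hB₂ (by omega) hi
  refine Runs.time_le (T₁ := 2 + (m * (3 + 1 + (402 * k + 120)) + (3 + 1) +
    (2 + (m * (3 + 1 + (402 * k + 150)) + (3 + 1))))) ?_ (Runs.seq <|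
    (Run.assign (0 : ℕ) ?_ ?_ <| Runs.seq <| (hins _ ?_).imp fun τ hτ => Runs.seq <|
      (Run.assign (0 : ℕ) ?_ ?_ <| (hext τ _ ?_).imp ?_).runs (T := 2) le_rfl).runs (T := 2) le_rfl)
  · nlinarith
  · simpa using fits_of_le le_rfl (by omega) hM
  · simp
  · refine ⟨hσ.set (by simp) (by simp), ?_, by simpa using h12, by simp, by simpa using h15, ?_⟩
    · convert hT.set (x := 13) (z := (0 : ℕ)) (by simp) using 1
      · funext l
        rw [if_neg (by omega)]
      · omega
    · intro a _
      simp
  · simpa using fits_of_le le_rfl (by omega) hM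
  · simp
  · refine ⟨hτ.base.set (by simp) (by simp), ?_, by simpa using hτ.reg12, by simp,
      by simpa using hτ.reg15, ?_, ?_⟩
    · convert hτ.tree.set (x := 13) (z := (0 : ℕ)) (by simp) using 1
      · funext l
        simp
      · omega
    · intro a _ _
      simp
    · intro x _ h
      omega
  · intro τ' hτ'
    refine ⟨hτ'.base, ?_, ?_, fun x hx => hτ'.sorted x hx (rank_lt hx)⟩
    · convert hτ'.tree using 1
      · funext l
        rw [eq_comm, ite_eq_right_iff]
        intro hl
        exact absurd (rank_lt hl.1) (not_lt.2 hl.2)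
      · omega
    · intro a ha haB
      rw [hτ'.mem a (by omega) haB, hτ.mem a ha]

end

/-! ### Keys and events -/

/-- Reads the number `n` of segments, and computes the least power `N` of `2` that is at least
`2 * n + 2`. -/
def setup : Cmd :=
  .assign 3 (.load 0) ;;
  .assign 4 1 ;;
  .while ((Expr.reg 4).lt (2 * .reg 3 + 2)) (.assign 4 (2 * .reg 4))

/-- The weight of the `x`-th segment, where `inp` is the input. -/
def weightOf (inp : ℕ → ℤ) (x : ℕ) : ℤ := inp (4 * x)

/-- The height of the `x`-th segment. -/
def heightOf (inp : ℕ → ℤ) (x : ℕ) : ℤ := inp (4 * x - 1)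

/-- The abscissa of the event with the code `x`: the codes `1, …, n` stand for the left endpoints of
the segments, and `n + 1, …, 2 * n` for the right ones. -/
def abscissaOf (n : ℕ) (inp : ℕ → ℤ) (x : ℕ) : ℤ :=
  if x ≤ n then inp (4 * x - 3) else inp (4 * (x - n) - 2)

/-- Computes `weightOf`. -/
def weightKey (r : ℕ) : Expr := .load (4 * .reg r)

/-- Computes `heightOf`. -/
def heightKey (r : ℕ) : Expr := .load (4 * .reg r - 1)

/-- Computes `abscissaOf`: the address for a right endpoint differs by `4 * n - 1` from the one for
a left endpoint with the same code. -/
def eventKey (r : ℕ) : Expr :=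
  .load (4 * .reg r - 3 - (4 * .reg 3 - 1) * (Expr.reg 3).lt (.reg r))

section

variable {b M : ℕ} {inp : ℕ → ℤ} {n N k : ℕ} {σ : State}

theorem keySpec_weightKey (hM : (M : ℤ) ≤ 2 ^ b) (hn : 4 * n < M) (h4 : 4 < M) :
    KeySpec b M inp n N weightKey (weightOf inp) n := by
  refine ⟨fun r => by simp [weightKey], fun σ r x hσ hr hx1 hx => ?_, fun σ r x hσ hr hx1 hx => ?_⟩
  · simp [weightKey, hr, Fits]
    omega
  · simp only [weightKey, Expr.eval_load, Expr.eval_mul, Expr.eval_ofNat, Expr.eval_reg, hr,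
      ← Nat.cast_mul, Int.toNat_natCast]
    exact hσ.mem _ (by omega)

theorem keySpec_heightKey (hM : (M : ℤ) ≤ 2 ^ b) (hn : 4 * n < M) (h4 : 4 < M) :
    KeySpec b M inp n N heightKey (heightOf inp) n := by
  refine ⟨fun r => by simp [heightKey], fun σ r x hσ hr hx1 hx => ?_, fun σ r x hσ hr hx1 hx => ?_⟩
  · simp [heightKey, hr, Fits]
    omega
  · simp only [heightKey, Expr.eval_load, Expr.eval_mul, Expr.eval_sub, Expr.eval_ofNat,
      Expr.eval_reg, hr]
    rw [show (((4 : ℕ) : ℤ) * x - ((1 : ℕ) : ℤ)).toNat = 4 * x - 1 by omega]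
    exact hσ.mem _ (by omega)

theorem keySpec_eventKey (hM : (M : ℤ) ≤ 2 ^ b) (hb : 1 ≤ b) (hn : 8 * n < M) (h4 : 4 < M) :
    KeySpec b M inp n N eventKey (abscissaOf n inp) (2 * n) := by
  refine ⟨fun r => by simp [eventKey], fun σ r x hσ hr hx1 hx => ?_, fun σ r x hσ hr hx1 hx => ?_⟩
  · have h3 := hσ.reg3
    by_cases hxn : n < x
    · simp [eventKey, hr, h3, Fits, hxn]
      omega
    · simp [eventKey, hr, h3, Fits, hxn]
      omega
  · have h3 := hσ.reg3
    by_cases hxn : n < x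
    · simp only [eventKey, Expr.eval_load, Expr.eval_mul, Expr.eval_sub, Expr.eval_ofNat,
        Expr.eval_lt, Expr.eval_reg, hr, h3, Nat.cast_lt, hxn, if_true, abscissaOf,
        if_neg (not_le.2 hxn)]
      rw [show (((4 : ℕ) : ℤ) * x - ((3 : ℕ) : ℤ) - (((4 : ℕ) : ℤ) * n - ((1 : ℕ) : ℤ)) * 1).toNat
        = 4 * (x - n) - 2 by omega]
      exact hσ.mem _ (by omega)
    · simp only [eventKey, Expr.eval_load, Expr.eval_mul, Expr.eval_sub, Expr.eval_ofNat,
        Expr.eval_lt, Expr.eval_reg, hr, h3, Nat.cast_lt, hxn, if_false, abscissaOf,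
        if_pos (not_lt.1 hxn)]
      rw [show (((4 : ℕ) : ℤ) * x - ((3 : ℕ) : ℤ) - (((4 : ℕ) : ℤ) * n - ((1 : ℕ) : ℤ)) * 0).toNat
        = 4 * x - 3 by omega]
      exact hσ.mem _ (by omega)

theorem runs_setup (hM : (M : ℤ) ≤ 2 ^ b) (hb : 2 ≤ b) (hN : N = 2 ^ Nat.clog 2 (2 * n + 2))
    (hNM : 2 * N ≤ M) (h0 : σ.mem 0 = n) :
    Runs b M setup σ (20 * Nat.clog 2 (2 * n + 2) + 20) fun τ =>
      τ.mem = σ.mem ∧ τ.reg 3 = n ∧ τ.reg 4 = N ∧ ∀ x, x ≠ 3 → x ≠ 4 → τ.reg x = σ.reg x := by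
  set k := Nat.clog 2 (2 * n + 2) with hk
  have hb4 : (2 : ℤ) ^ 2 ≤ 2 ^ b := pow_le_pow_right₀ (by norm_num) hb
  have hnN : 2 * n + 2 ≤ N := hN ▸ Nat.le_pow_clog (by norm_num) _
  have hpow : ∀ i ≤ k, 2 ^ i ≤ N := fun i hi => hN ▸ Nat.pow_le_pow_right (by norm_num) hi
  refine Runs.time_le (T₁ := 3 + (2 + (k * (7 + 1 + 4) + (7 + 1)))) ?_ <| Runs.seq <|
    (Run.load 0 n ?_ ?_ ?_ h0 <| Runs.seq <| (Run.assign (1 : ℕ) ?_ ?_ <|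
    Runs.imp (Runs.loop (fun i τ => τ.mem = σ.mem ∧ τ.reg 3 = n ∧ τ.reg 4 = (2 ^ i : ℕ) ∧
      ∀ x, x ≠ 3 → x ≠ 4 → τ.reg x = σ.reg x) k ?_ ?_ ?_ ?_) ?_).runs (T := 2) le_rfl).runs
      (T := 3) le_rfl
  · omega
  · simp [Fits]
  · simp
  · omega
  · simp [Fits]
    omega
  · simp
  · refine ⟨rfl, by simp, by simp, fun x h3 h4 => ?_⟩
    simp [h3, h4]
  · rintro i hi τ ⟨-, h3, h4, -⟩
    simp [h3, Fits]
    omega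
  · rintro i hi τ ⟨hm, h3, h4, hr⟩
    have hlt : 2 ^ i < 2 * n + 2 := by
      by_contra! h
      exact absurd (Nat.clog_le_of_le_pow h) (by omega)
    have hle := hpow (i + 1) hi
    have hs : 2 ^ (i + 1) = 2 * 2 ^ i := pow_succ' 2 i
    constructor
    · simp only [Expr.eval_lt, Expr.eval_reg, Expr.eval_add, Expr.eval_mul, Expr.eval_ofNat, h3, h4]
      rw [if_pos (by omega)]
      simp
    · refine (Run.assign (2 ^ (i + 1) : ℕ) ?_ ?_ ⟨hm, ?_, ?_, ?_⟩).runs le_rfl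
      · simp only [Expr.ok_mul, Expr.ok_ofNat, Expr.ok_reg, Expr.eval_ofNat, Expr.eval_reg, h4,
          Fits, true_and]
        omega
      · simp only [Expr.eval_mul, Expr.eval_ofNat, Expr.eval_reg, h4]
        omega
      · simp [h3]
      · simp
      · intro x hx3 hx4
        simp [hx4, hr x hx3 hx4]
  · rintro τ ⟨-, h3, h4, -⟩
    simp only [Expr.eval_lt, Expr.eval_reg, Expr.eval_add, Expr.eval_mul, Expr.eval_ofNat, h3, h4,
      ← hN]
    rw [if_neg (by omega)]
  · rintro τ ⟨hm, h3, h4, hr⟩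
    exact ⟨hm, h3, hN ▸ h4, hr⟩

end

/-- Segment `x` is stabbed after the first `e` events: its left endpoint is among them, and its
right one is not. -/
def Active (n : ℕ) (inp : ℕ → ℤ) (e x : ℕ) : Prop :=
  rank (abscissaOf n inp) (2 * n) x < e ∧ e ≤ rank (abscissaOf n inp) (2 * n) (n + x)

/-- `f` describes the tree after the first `e` events: every active segment is on the leaf whose
number is one more than the rank of its weight. -/
def Snapshot (n : ℕ) (inp : ℕ → ℤ) (e : ℕ) (f : ℕ → ℕ) : Prop :=
  ∀ l x, x ≠ 0 →
    (f l = x ↔ x ∈ Finset.Icc 1 n ∧ rank (weightOf inp) n x + 1 = l ∧ Active n inp e x)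

section

variable {inp : ℕ → ℤ} {n e x : ℕ} {f : ℕ → ℕ}

theorem Snapshot.le (H : Snapshot n inp e f) (l : ℕ) : f l ≤ n := by
  by_cases h : f l = 0
  · omega
  · exact (Finset.mem_Icc.1 ((H l _ h).1 rfl).1).2

theorem snapshot_zero : Snapshot n inp 0 fun _ => 0 := by
  intro l x hx
  simp [Active, hx.symm]

theorem Snapshot.insert (H : Snapshot n inp e f) (hx : x ∈ Finset.Icc 1 n)
    (hxe : rank (abscissaOf n inp) (2 * n) x = e)
    (hlt : e < rank (abscissaOf n inp) (2 * n) (n + x)) :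
    Snapshot n inp (e + 1) (Function.update f (rank (weightOf inp) n x + 1) x) := by
  intro l y hy
  have hx1 := Finset.mem_Icc.1 hx
  by_cases hl : l = rank (weightOf inp) n x + 1
  · subst hl
    rw [Function.update_self]
    constructor
    · rintro rfl
      exact ⟨hx, rfl, by omega, by omega⟩
    · rintro ⟨hyn, h, -⟩
      exact (rank_inj (κ := weightOf inp) hyn hx (by omega)).symm
  · rw [Function.update_of_ne hl, H l y hy]
    refine and_congr_right fun hyn => and_congr_right fun h => ?_
    have hy1 := Finset.mem_Icc.1 hyn
    have h1 : rank (abscissaOf n inp) (2 * n) y ≠ e := by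
      intro h'
      have := rank_inj (Finset.mem_Icc.2 (by omega)) (Finset.mem_Icc.2 (by omega))
        (h'.trans hxe.symm)
      subst this
      exact hl h.symm
    have h2 : rank (abscissaOf n inp) (2 * n) (n + y) ≠ e := by
      intro h'
      have := rank_inj (Finset.mem_Icc.2 (by omega)) (Finset.mem_Icc.2 (by omega))
        (h'.trans hxe.symm)
      omega
    unfold Active
    omega

theorem Snapshot.delete (H : Snapshot n inp e f) (hx : x ∈ Finset.Icc 1 n)
    (hxe : rank (abscissaOf n inp) (2 * n) (n + x) = e) :
    Snapshot n inp (e + 1) (Function.update f (rank (weightOf inp) n x + 1) 0) := by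
  intro l y hy
  have hx1 := Finset.mem_Icc.1 hx
  by_cases hl : l = rank (weightOf inp) n x + 1
  · subst hl
    rw [Function.update_self]
    constructor
    · intro h
      exact absurd h.symm hy
    · rintro ⟨hyn, h, -, hact⟩
      obtain rfl := rank_inj (κ := weightOf inp) hyn hx (by omega)
      omega
  · rw [Function.update_of_ne hl, H l y hy]
    refine and_congr_right fun hyn => and_congr_right fun h => ?_
    have hy1 := Finset.mem_Icc.1 hyn
    have h1 : rank (abscissaOf n inp) (2 * n) y ≠ e := by
      intro h'
      have := rank_inj (Finset.mem_Icc.2 (by omega)) (Finset.mem_Icc.2 (by omega))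
        (h'.trans hxe.symm)
      omega
    have h2 : rank (abscissaOf n inp) (2 * n) (n + y) ≠ e := by
      intro h'
      have := rank_inj (Finset.mem_Icc.2 (by omega)) (Finset.mem_Icc.2 (by omega))
        (h'.trans hxe.symm)
      obtain rfl : y = x := by omega
      exact hl h.symm
    unfold Active
    omega

end

/-! ### The preprocessing -/

/-- Prepares the update of the tree for the next event. -/
def nextEvent : Cmd :=
  .assign 14 (.load (4 * .reg 4 + .reg 13)) ;;
  .ite ((Expr.reg 3).lt (.reg 14)) (.assign 7 0 ;; .assign 14 (.reg 14 - .reg 3))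
    (.assign 7 (.reg 14)) ;;
  .assign 6 (.load (7 * .reg 4 + .reg 14)) ;;
  .assign 6 (.reg 4 + .reg 6 + 1)

/-- Stores the address of the root after the event. -/
def storeRoot : Cmd :=
  .assign 13 (.reg 13 + 1) ;;
  .assign 14 (.load (2 * .reg 4 + 1)) ;;
  .store (8 * .reg 4 + .reg 13) (.reg 14)

/-- Goes through the events from left to right, and keeps the tree of the active segments after each
of them. -/
def sweep : Cmd :=
  .while ((Expr.reg 13).lt (.reg 12)) (nextEvent ;; update heightKey ;; storeRoot)

/-- Sets the registers `12` and `15` for sorting the events. -/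
def beforeEvents : Cmd :=
  .assign 5 3 ;; .assign 12 (2 * .reg 3) ;; .assign 15 (4 * .reg 4)

/-- Sets the registers `12` and `15` for sorting the segments by weight. -/
def beforeWeights : Cmd :=
  .assign 12 (.reg 3) ;; .assign 15 (6 * .reg 4)

/-- Sets the registers `12` and `13` for the sweep. -/
def beforeSweep : Cmd :=
  .assign 12 (2 * .reg 3) ;; .assign 13 0

/-- The preprocessing program. The memory consists of blocks of `N` cells. The input is in the
blocks `0` and `1`, the current tree in `2` and `3`, the sorted events and their ranks in `4` and
`5`, the segments sorted by weight and their ranks in `6` and `7`, the addresses of the roots in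
`8`, and the records in all the blocks from `9` on. -/
def build : Cmd :=
  setup ;; beforeEvents ;; sort eventKey ;; beforeWeights ;; sort weightKey ;; beforeSweep ;; sweep

/-- The root of the tree after the first `e` events is recorded. -/
def HasRoot (n N k : ℕ) (inp : ℕ → ℤ) (lim : ℕ) (D : ℕ → ℤ) (e : ℕ) : Prop :=
  ∃ (f : ℕ → ℕ) (p : ℕ), Snapshot n inp e f ∧ D (8 * N + e) = p ∧
    Rep (heightOf inp) f (fun a => D (9 * N + a)) lim k 0 p

/-- The orders of the events and of the weights are recorded. -/
structure HasOrders (n N : ℕ) (inp : ℕ → ℤ) (D : ℕ → ℤ) : Prop where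
  event : ∀ x ∈ Finset.Icc 1 (2 * n), D (4 * N + rank (abscissaOf n inp) (2 * n) x) = x
  weight : ∀ x ∈ Finset.Icc 1 n, D (6 * N + rank (weightOf inp) n x) = x
  weightRank : ∀ x ∈ Finset.Icc 1 n, D (7 * N + x) = rank (weightOf inp) n x

/-- The state of the sweep after `i` events: the current tree describes the active segments, and the
roots of all the versions up to now are recorded. -/
structure SweepInv (n N k : ℕ) (inp : ℕ → ℤ) (lim i : ℕ) (σ : State) : Prop where
  base : Base inp n N σ
  tree : ∃ f, Snapshot n inp i f ∧ Tree (heightOf inp) f N k (lim + i * (3 * (k + 1))) σ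
  reg12 : σ.reg 12 = (2 * n : ℕ)
  reg13 : σ.reg 13 = i
  orders : HasOrders n N inp σ.mem
  root : ∀ e ≤ i, HasRoot n N k inp (lim + i * (3 * (k + 1))) σ.mem e

section

variable {b M : ℕ} {inp : ℕ → ℤ} {n N k : ℕ} {σ : State}

theorem HasOrders.congr {D D' : ℕ → ℤ} (H : HasOrders n N inp D) (hnN : 2 * n < N)
    (h : ∀ a, 4 * N ≤ a → a < 8 * N → D' a = D a) : HasOrders n N inp D' := by
  refine ⟨fun x hx => ?_, fun x hx => ?_, fun x hx => ?_⟩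
  · have := rank_lt (κ := abscissaOf n inp) hx
    rw [h _ (by omega) (by omega), H.event x hx]
  · have := rank_lt (κ := weightOf inp) hx
    rw [h _ (by omega) (by omega), H.weight x hx]
  · have := Finset.mem_Icc.1 hx
    rw [h _ (by omega) (by omega), H.weightRank x hx]

theorem SweepInv.step {lim i : ℕ} (hb : 2 ≤ b) (hM : (M : ℤ) ≤ 2 ^ b) (hN : N = 2 ^ k)
    (hnN : 2 * n + 2 ≤ N) (hM' : 9 * N + lim + 2 * n * (3 * (k + 1)) ≤ M) (hi : i < 2 * n)
    (hlt : ∀ x ∈ Finset.Icc 1 n,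
      rank (abscissaOf n inp) (2 * n) x < rank (abscissaOf n inp) (2 * n) (n + x))
    (H : SweepInv n N k inp lim i σ) :
    Runs b M (nextEvent ;; update heightKey ;; storeRoot) σ (402 * k + 200)
      (SweepInv n N k inp lim (i + 1)) := by
  have h3 := H.base.reg3
  have h4 := H.base.reg4
  have h13 := H.reg13
  have hd : (i + 1) * (3 * (k + 1)) = i * (3 * (k + 1)) + 3 * (k + 1) := by ring
  have hdm : (i + 1) * (3 * (k + 1)) ≤ 2 * n * (3 * (k + 1)) := Nat.mul_le_mul_right _ hi
  obtain ⟨z, hz, hzi⟩ := exists_rank_eq (κ := abscissaOf n inp) hi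
  obtain ⟨f, hf, hT⟩ := H.tree
  have hzm := H.orders.event z hz
  rw [hzi] at hzm
  rw [Finset.mem_Icc] at hz
  obtain ⟨x, c, hx, hc, hsnap⟩ : ∃ x c, x ∈ Finset.Icc 1 n ∧
      ((n < z ∧ z = n + x ∧ c = 0) ∨ (¬ n < z ∧ z = x ∧ c = z)) ∧
      Snapshot n inp (i + 1) (Function.update f (rank (weightOf inp) n x + 1) c) := by
    by_cases hzn : n < z
    · have hx : z - n ∈ Finset.Icc 1 n := Finset.mem_Icc.2 (by omega)
      exact ⟨z - n, 0, hx, .inl ⟨hzn, by omega, rfl⟩,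
        hf.delete hx (by rw [show n + (z - n) = z by omega, hzi])⟩
    · have hx : z ∈ Finset.Icc 1 n := Finset.mem_Icc.2 (by omega)
      exact ⟨z, z, hx, .inr ⟨hzn, rfl, rfl⟩, hf.insert hx hzi (hzi ▸ hlt z hx)⟩
  have hx1 := Finset.mem_Icc.1 hx
  have hxr := rank_lt (κ := weightOf inp) hx
  have hxw := H.orders.weightRank x hx
  set w := rank (weightOf inp) n x with hw
  have hpre : Run b M nextEvent σ fun τ => τ.mem = σ.mem ∧ τ.reg 6 = (N + (w + 1) : ℕ) ∧
      τ.reg 7 = c ∧ ∀ y, y < 6 ∨ y = 12 ∨ y = 13 → τ.reg y = σ.reg y := by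
    refine Run.seq <| Run.load (4 * N + i) z ?_ ?_ ?_ hzm <|
      Run.seq <| Run.ite ?_ (fun hcond => Run.seq <| Run.assign (0 : ℕ) ?_ ?_ <|
        Run.assign (x : ℕ) ?_ ?_ ?_) (fun hcond => Run.assign (x : ℕ) ?_ ?_ ?_)
    · simp [h4, h13, Fits]
      omega
    · simp [h4, h13]
    · omega
    · simp
      omega
    · simp [Fits]
    · simp
    · simp [h3, Fits]
      omega
    · have : n < z := by simpa [h3] using hcond
      simp [h3]
      omega
    rotate_left
    · simp
    · have : ¬ n < z := by simpa [h3] using hcond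
      simp
      omega
    all_goals
      simp [h3] at hcond
      refine Run.seq <| Run.load (7 * N + x) w ?_ ?_ ?_ hxw <|
        Run.assign (N + (w + 1) : ℕ) ?_ ?_ ⟨rfl, ?_, ?_, ?_⟩
      · simp [h4, Fits]
        omega
      · simp [h4] <;> omega
      · omega
      · simp [h4, Fits]
        omega
      · simp [h4]
        omega
      · simp
      · simp
        omega
      · intro y hy
        simp [show y ≠ 6 by omega, show y ≠ 7 by omega, show y ≠ 14 by omega]
  refine Runs.time_le ?_ (Runs.seq (hpre.imp ?_))
    (T₁ := nextEvent.bound + (402 * k + 100 + storeRoot.bound))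
  · have h1 : nextEvent.bound ≤ 60 := by decide
    have h2 : storeRoot.bound ≤ 30 := by decide
    omega
  rintro τ ⟨hm, h6, h7, hr⟩
  refine Runs.seq ((runs_update (keySpec_heightKey hM (by omega) (by omega)) hb hM hN (by omega)
    (l := w + 1) (x := c) (f := f) (by omega) hf.le (by omega)
    (lim := lim + i * (3 * (k + 1))) (by omega)
    (H.base.of_eq (hr 3 (by omega)) (hr 4 (by omega)) fun a _ => by rw [hm])
    ⟨by rw [hr 5 (by omega), hT.reg5], by simpa only [hm] using hT.node⟩ h6 h7).imp ?_)
  rintro ρ ⟨hB, hT', hr', hm'⟩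
  obtain ⟨q, hq, hQ⟩ := hT'.root
  rw [show lim + i * (3 * (k + 1)) + 3 * (k + 1) = lim + (i + 1) * (3 * (k + 1)) by omega] at hT' hQ
  have h4' := hB.reg4
  have h13' : ρ.reg 13 = i := by rw [hr' 13 (by omega), hr 13 (by omega), h13]
  have hpost : Run b M storeRoot ρ fun υ =>
      υ = ((ρ.set 13 (i + 1 : ℕ)).set 14 q).put (8 * N + (i + 1)) q := by
    refine Run.seq <| Run.assign (i + 1 : ℕ) ?_ ?_ <|
      Run.seq <| Run.load (2 * N + 1) q ?_ ?_ ?_ hq <|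
      Run.store (8 * N + (i + 1)) q ?_ ?_ ?_ ?_ rfl
    all_goals
      try simp [h4', h13']
      try unfold Fits
      try omega
  refine hpost.imp ?_
  rintro _ rfl
  refine ⟨?_, ⟨_, hsnap, ?_⟩, ?_, by simp, ?_, ?_⟩
  · exact ((hB.set (by simp) (by simp)).set (by simp) (by simp)).put (by omega)
  · exact ((hT'.set (by simp)).set (by simp)).put hN (by omega)
  · simp [hr' 12 (by omega), hr 12 (by omega), H.reg12]
  · refine H.orders.congr (by omega) fun a h1 h2 => ?_
    simp [show a ≠ 8 * N + (i + 1) by omega, hm' a (by omega), hm]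
  · intro e he
    rcases Nat.lt_or_eq_of_le he with he | rfl
    · obtain ⟨g, p, hg, hp, hP⟩ := H.root e (by omega)
      refine ⟨g, p, hg, ?_, hP.frame (by omega) fun a ha => ?_⟩
      · simp [show e ≠ i + 1 by omega, hm' (8 * N + e) (by omega), hm, hp]
      · simp [show 9 * N + a ≠ 8 * N + (i + 1) by omega, hm' (9 * N + a) (by omega), hm]
    · refine ⟨_, q, hsnap, by simp, hQ.frame le_rfl fun a ha => ?_⟩
      simp [show 9 * N + a ≠ 8 * N + (i + 1) by omega]

theorem runs_sweep {lim : ℕ} (hb : 2 ≤ b) (hM : (M : ℤ) ≤ 2 ^ b) (hN : N = 2 ^ k)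
    (hnN : 2 * n + 2 ≤ N) (hM' : 9 * N + lim + 2 * n * (3 * (k + 1)) ≤ M)
    (hlt : ∀ x ∈ Finset.Icc 1 n,
      rank (abscissaOf n inp) (2 * n) x < rank (abscissaOf n inp) (2 * n) (n + x))
    (H : SweepInv n N k inp lim 0 σ) :
    Runs b M sweep σ (2 * n * (402 * k + 204) + 4) (SweepInv n N k inp lim (2 * n)) := by
  refine Runs.time_le (T₁ := 2 * n * (3 + 1 + (402 * k + 200)) + (3 + 1)) (by ring_nf; omega) <|
    Runs.loop _ (2 * n) H (fun i hi τ hτ => by simp; omega) (fun i hi τ hτ => ⟨?_, ?_⟩)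
      fun τ hτ => by simp [hτ.reg12, hτ.reg13]
  · simp only [Expr.eval_lt, Expr.eval_reg, hτ.reg12, hτ.reg13, Nat.cast_lt, hi, if_true]
    simp
  · exact hτ.step hb hM hN hnN hM' hi hlt

/-- The data structure: the input, the two sorted orders, and a root for each version of the tree.
-/
structure Stored (n N k : ℕ) (inp : ℕ → ℤ) (lim : ℕ) (D : ℕ → ℤ) : Prop where
  input : ∀ a ≤ 4 * n, D a = inp a
  orders : HasOrders n N inp D
  root : ∀ e ≤ 2 * n, HasRoot n N k inp lim D e

/-- The preprocessing takes time proportional to `n * (k + 1)`, and stays within the memory. -/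
theorem runs_build (hb : 2 ≤ b) (hM : (M : ℤ) ≤ 2 ^ b) (hk : k = Nat.clog 2 (2 * n + 2))
    (hN : N = 2 ^ k) (hM' : 9 * N + 3 + 8 * (n * (3 * (k + 1))) ≤ M) (h0 : inp 0 = n)
    (hinp : ∀ a > 4 * n, inp a = 0) (hσ : σ.mem = inp)
    (hlr : ∀ x ∈ Finset.Icc 1 n, inp (4 * x - 3) ≤ inp (4 * x - 2)) :
    Runs b M build σ (4000 * (n * (k + 1)) + 20 * k + 500) fun τ =>
      ∃ lim, 9 * N + lim ≤ M ∧ Stored n N k inp lim τ.mem := by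
  have hnN : 2 * n + 2 ≤ N := hN ▸ hk ▸ Nat.le_pow_clog (by norm_num) _
  have hlt : ∀ x ∈ Finset.Icc 1 n,
      rank (abscissaOf n inp) (2 * n) x < rank (abscissaOf n inp) (2 * n) (n + x) := by
    intro x hx
    have hx1 := Finset.mem_Icc.1 hx
    rw [rank_lt_iff (Finset.mem_Icc.2 (by omega)) (Finset.mem_Icc.2 (by omega))]
    have := hlr x hx
    unfold Before abscissaOf
    rw [if_pos (by omega), if_neg (by omega), show n + x - n = x by omega]
    omega
  set d := n * (3 * (k + 1)) with hd
  have hd2 : 2 * n * (3 * (k + 1)) = 2 * d := by rw [hd]; ring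
  have hKe : KeySpec b M inp n N eventKey (abscissaOf n inp) (2 * n) :=
    keySpec_eventKey hM (by omega) (by omega) (by omega)
  have hKw : KeySpec b M inp n N weightKey (weightOf inp) n :=
    keySpec_weightKey hM (by omega) (by omega)
  refine Runs.time_le (T₁ := 20 * k + 20 + (15 + (900 * (2 * n * (k + 1)) + 100 + (15 +
    (900 * (n * (k + 1)) + 100 + (15 + (2 * n * (402 * k + 204) + 4))))))) ?_ <| Runs.seq <|
    (hk ▸ runs_setup hM hb (hk ▸ hN) (by omega) (by rw [hσ, h0])).imp ?_
  · have h1 : 2 * n * (k + 1) = 2 * (n * (k + 1)) := by ring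
    have h2 : 2 * n * (402 * k + 204) ≤ 804 * (n * (k + 1)) :=
      calc 2 * n * (402 * k + 204) ≤ 2 * n * (402 * (k + 1)) := Nat.mul_le_mul_left _ (by omega)
        _ = 804 * (n * (k + 1)) := by ring
    omega
  rintro τ ⟨hm, h3, h4, -⟩
  have hB : Base inp n N τ := ⟨h3, h4, fun a _ => by rw [hm, hσ]⟩
  have hpre : Run b M beforeEvents τ fun υ =>
      υ = ((τ.set 5 (3 : ℕ)).set 12 (2 * n : ℕ)).set 15 (4 * N : ℕ) := by
    refine Run.seq <| Run.assign (3 : ℕ) ?_ ?_ <| Run.seq <| Run.assign (2 * n : ℕ) ?_ ?_ <|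
      Run.assign (4 * N : ℕ) ?_ ?_ rfl
    all_goals
      try simp [h3, h4]
      try unfold Fits
      try omega
  refine Runs.seq <| (hpre.runs (T := 15) (by decide)).imp ?_
  rintro _ rfl
  refine Runs.seq <| (runs_sort hKe hb hM hN (by omega) (by omega) (B := 4 * N) (lim := 3)
    (by omega) (by omega) (by omega) (((hB.set ?_ ?_).set ?_ ?_).set ?_ ?_) ⟨?_, ?_⟩ ?_ ?_).imp ?_
  any_goals simp
  · intro h hh j hj
    have hcN : 2 ^ (k - h) ≤ N := hN ▸ Nat.pow_le_pow_right (by norm_num) (by omega)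
    refine ⟨0, ?_, Rep.null le_rfl fun a ha => ?_⟩
    · rw [hm, hσ, hinp _ (by omega), Nat.cast_zero]
    · rw [hm, hσ, hinp _ (by omega)]
  intro υ hB' hT' hmem' hsort'
  have h3' := hB'.reg3
  have h4' := hB'.reg4
  have hpre' : Run b M beforeWeights υ fun ρ =>
      ρ = (υ.set 12 n).set 15 (6 * N : ℕ) := by
    refine Run.seq <| Run.assign (n : ℕ) ?_ ?_ <| Run.assign (6 * N : ℕ) ?_ ?_ rfl
    all_goals
      try simp [h3', h4']
      try unfold Fits
      try omega
  refine Runs.seq <| (hpre'.runs (T := 15) (by decide)).imp ?_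
  rintro _ rfl
  refine Runs.seq <| (runs_sort hKw hb hM hN (by omega) (by omega)
    (B := 6 * N) (lim := 3 + 2 * (2 * n * (3 * (k + 1)))) (by omega)
    (by omega) (by omega) ((hB'.set ?_ ?_).set ?_ ?_) ((hT'.rekey.set ?_).set ?_) ?_ ?_).imp ?_
  any_goals simp
  intro ρ hB'' hT'' hmem'' hsort''
  have h3'' := hB''.reg3
  -- Neither the block of the roots nor the null record has been touched by the two sorts.
  have hzero : ∀ a, 8 * N ≤ a → a < 9 * N + 3 → ρ.mem a = 0 := by
    intro a h1 h2
    rw [hmem'' a (by omega) (by omega), hmem' a (by omega) (by omega), hm, hσ, hinp a (by omega)]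
  have hpre'' : Run b M beforeSweep ρ fun π =>
      π = (ρ.set 12 (2 * n : ℕ)).set 13 (0 : ℕ) := by
    refine Run.seq <| Run.assign (2 * n : ℕ) ?_ ?_ <| Run.assign (0 : ℕ) ?_ ?_ rfl
    all_goals
      try simp [h3'']
      try unfold Fits
      try omega
  refine Runs.seq <| (hpre''.runs (T := 15) (by decide)).imp ?_
  rintro _ rfl
  refine (runs_sweep hb hM hN hnN
    (lim := 3 + 2 * (2 * n * (3 * (k + 1))) + 2 * (n * (3 * (k + 1)))) (by omega) hlt
    ⟨(hB''.set ?_ ?_).set ?_ ?_, ⟨_, snapshot_zero, ?_⟩, ?_, ?_, ?_, ?_⟩).imp ?_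
  any_goals simp only [zero_mul, add_zero]
  · simp
  · simp
  · simp
  · simp
  · exact (hT''.rekey.set (by simp)).set (by simp)
  · simp
  · simp
  · refine ⟨fun x hx => ?_, fun x hx => ?_, fun x hx => ?_⟩
    · have hx1 := Finset.mem_Icc.1 hx
      have := rank_lt (κ := abscissaOf n inp) hx
      rw [State.mem_set, State.mem_set, hmem'' _ (by omega) (by omega)]
      exact (hsort' x hx1.1 hx1.2).1
    · have hx1 := Finset.mem_Icc.1 hx
      exact (hsort'' x hx1.1 hx1.2).1
    · have hx1 := Finset.mem_Icc.1 hx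
      rw [← (hsort'' x hx1.1 hx1.2).2, State.mem_set, State.mem_set,
        show 7 * N + x = 6 * N + N + x by ring]
  · intro e he
    obtain rfl : e = 0 := by omega
    refine ⟨_, 0, snapshot_zero, ?_, Rep.null (by omega) fun a ha => ?_⟩
    · simpa using hzero (8 * N) (by omega) (by omega)
    · exact hzero _ (by omega) (by omega)
  · intro π hπ
    exact ⟨_, by omega, hπ.base.mem, hπ.orders, hπ.root⟩

end

/-! ### Searching and descending -/

/-- Halves the step length in register `6`, and advances the position in register `5` by a step if
the code before the new position satisfies the test `pred`, which reads it from register `7`. -/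
def searchStep (pred : Expr) : Cmd :=
  .assign 6 (.reg 6 / 2) ;;
  .ite ((Expr.reg 5 + .reg 6).lt (.reg 14 + 1))
    (.assign 7 (.load (.reg 15 + .reg 5 + .reg 6 - 1)) ;;
      .ite pred (.assign 5 (.reg 5 + .reg 6)) .skip)
    .skip

/-- Binary search: counts the entries that satisfy the test `pred` in a sorted array, whose length
is in register `14` and whose address is in register `15`. -/
def search (pred : Expr) : Cmd :=
  (.assign 5 0 ;; .assign 6 (.reg 4)) ;; .while ((1 : Expr).lt (.reg 6)) (searchStep pred)

/-- Compares the best code so far, in register `12`, with the one of the record whose address is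
stored at the address `e`. -/
def visit (e : Expr) : Cmd :=
  .assign 7 (.load e) ;; .assign 7 (.load (9 * .reg 4 + .reg 7 + 2)) ;; pick heightKey 12 7

/-- Finds out which children of the current records contain the leaves in the registers `10` and
`11`, and whether these records belong to different blocks of leaves. -/
def findChildren : Cmd :=
  .assign 6 (.reg 6 / 2) ;;
  .assign 13 (.reg 10 / .reg 6) ;;
  .assign 14 (.reg 11 / .reg 6) ;;
  .assign 15 ((Expr.reg 13 / 2).lt (.reg 14 / 2)) ;;
  .assign 13 (.reg 13 - 2 * (.reg 13 / 2)) ;;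
  .assign 14 (.reg 14 - 2 * (.reg 14 / 2))

/-- Moves on to the children. -/
def moveDown : Cmd :=
  .assign 8 (.load (9 * .reg 4 + .reg 8 + .reg 13)) ;;
  .assign 9 (.load (9 * .reg 4 + .reg 9 + .reg 14))

/-- Goes down one level in the tree, from the records with the addresses in the registers `8` and
`9`. The children that lie strictly between the two new ones are visited. -/
def descendStep : Cmd :=
  findChildren ;;
  .ite (Expr.reg 15 * (1 - .reg 13)) (visit (9 * .reg 4 + .reg 8 + 1)) .skip ;;
  .ite (Expr.reg 15 * .reg 14) (visit (9 * .reg 4 + .reg 9)) .skip ;;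
  moveDown

/-- Goes down from the root to the leaves. -/
def descend : Cmd :=
  .while ((1 : Expr).lt (.reg 6)) descendStep

section

variable {b M : ℕ} {inp : ℕ → ℤ} {n N k m : ℕ} {κ : ℕ → ℤ} {σ : State}

/-- The search finds the number `c` of entries that satisfy the test. Register `6` holds the powers
of `2` below `N`, and `c` is always less than this power away from the current position. -/
theorem runs_search {pred : Expr} {c B : ℕ} (hb : 2 ≤ b) (hM : (M : ℤ) ≤ 2 ^ b) (hN : N = 2 ^ k)
    (hcm : c ≤ m) (hmN : m < N) (hBM : B + 2 * N ≤ M) (h4 : σ.reg 4 = N) (h14 : σ.reg 14 = m)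
    (h15 : σ.reg 15 = B) (hcost : pred.cost ≤ 60)
    (harr : ∀ x ∈ Finset.Icc 1 m, σ.mem (B + rank κ m x) = x)
    (hpred : ∀ τ : State, ∀ x ∈ Finset.Icc 1 m, τ.mem = σ.mem →
      (∀ y, y ≠ 5 → y ≠ 6 → y ≠ 7 → τ.reg y = σ.reg y) → τ.reg 7 = x →
      pred.Ok b M τ ∧ (pred.eval τ ≠ 0 ↔ rank κ m x < c)) :
    Runs b M (search pred) σ (150 * k + 20) fun τ =>
      τ.mem = σ.mem ∧ (∀ y, y ≠ 5 → y ≠ 6 → y ≠ 7 → τ.reg y = σ.reg y) ∧ τ.reg 5 = c := by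
  have hstep : (searchStep pred).bound ≤ 100 := by
    simp only [searchStep, Cmd.bound, Expr.cost_reg, Expr.cost_add, Expr.cost_sub, Expr.cost_div,
      Expr.cost_ofNat, Expr.cost_load, Expr.cost_lt]
    omega
  have hb4 : (2 : ℤ) ^ 2 ≤ 2 ^ b := pow_le_pow_right₀ (by norm_num) hb
  have hpre : Run b M (.assign 5 0 ;; .assign 6 (.reg 4)) σ fun τ =>
      τ = (σ.set 5 (0 : ℕ)).set 6 N := by
    refine Run.seq <| Run.assign (0 : ℕ) ?_ ?_ <| Run.assign N ?_ ?_ rfl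
    all_goals simp [h4, Fits]
  refine Runs.time_le (T₁ := 5 + (k * (3 + 1 + 100) + (3 + 1))) (by omega) <| Runs.seq <|
    (hpre.runs (T := 5) (by decide)).imp ?_
  rintro _ rfl
  refine (Runs.loop (fun i τ => τ.mem = σ.mem ∧ (∀ y, y ≠ 5 → y ≠ 6 → y ≠ 7 → τ.reg y = σ.reg y) ∧
    τ.reg 6 = (2 ^ (k - i) : ℕ) ∧ ∃ p : ℕ, τ.reg 5 = p ∧ p ≤ c ∧ c < p + 2 ^ (k - i)) k
    ?_ ?_ ?_ ?_).imp ?_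
  · refine ⟨rfl, fun y h5 h6 h7 => by simp [h5, h6], by simp [hN], 0, by simp, by omega, ?_⟩
    rw [Nat.sub_zero, ← hN]
    omega
  · rintro i hi τ -
    simp [Fits]
    omega
  · rintro i hi τ ⟨hm, hr, h6, p, h5, hpc, hcp⟩
    have hs : 2 ^ (k - i) = 2 * 2 ^ (k - (i + 1)) := by rw [← pow_succ']; congr 1; omega
    have hpos : 0 < 2 ^ (k - (i + 1)) := by positivity
    have hpN : 2 ^ (k - i) ≤ N := hN ▸ Nat.pow_le_pow_right (by norm_num) (by omega)
    set s := 2 ^ (k - (i + 1)) with hsdef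
    rw [hs] at h6 hcp hpN
    have h14' : τ.reg 14 = m := by rw [hr 14 (by simp) (by simp) (by simp), h14]
    have h15' : τ.reg 15 = B := by rw [hr 15 (by simp) (by simp) (by simp), h15]
    constructor
    · simp only [Expr.eval_lt, Expr.eval_ofNat, Expr.eval_reg, h6, Nat.cast_lt]
      rw [if_pos (by omega)]
      simp
    refine (Run.seq <| Run.assign (s : ℕ) ?_ ?_ <| Run.ite ?_ (fun hlt => ?_)
      (fun hlt => Run.skip ?_)).runs hstep
    · simp [h6, Fits]
      omega
    · simp [h6]
    · simp [h5, h14', Fits]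
      omega
    · have hle : p + s ≤ m := by
        simp [h5, h14'] at hlt
        omega
      obtain ⟨x, hx, hxp⟩ := exists_rank_eq (κ := κ) (show p + s - 1 < m by omega)
      refine Run.seq <| Run.load (B + (p + s - 1)) x ?_ ?_ ?_ ?_ <| ?_
      · simp [h5, h15', Fits]
        omega
      · simp [h5, h15']
        omega
      · omega
      · rw [State.mem_set, hm, ← hxp, harr x hx]
      · obtain ⟨hok, hiff⟩ := hpred ((τ.set 6 s).set 7 x) x hx hm
          (fun y h5 h6 h7 => by simp [h6, h7, hr y h5 h6 h7]) (by simp)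
        refine Run.ite hok (fun hp => Run.assign (p + s : ℕ) ?_ ?_ ?_) (fun hp => Run.skip ?_)
        · simp [h5, Fits]
          omega
        · simp [h5]
        · rw [hiff] at hp
          refine ⟨hm, fun y h5 h6 h7 => by simp [h5, h6, h7, hr y h5 h6 h7], by simp, p + s,
            by simp, by omega, by omega⟩
        · have hp' : ¬ rank κ m x < c := fun h => hiff.2 h hp
          exact ⟨hm, fun y h5 h6 h7 => by simp [h6, h7, hr y h5 h6 h7], by simp, p,
            by simp [h5], hpc, by omega⟩
    · have hle : m < p + s := by
        simp [h5, h14'] at hlt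
        omega
      exact ⟨hm, fun y h5 h6 h7 => by simp [h6, hr y h5 h6 h7], by simp, p,
        by simp [h5], hpc, by omega⟩
  · rintro τ ⟨-, -, h6, -⟩
    simp [h6]
  · rintro τ ⟨hm, hr, -, p, h5, hpc, hcp⟩
    rw [Nat.sub_self, pow_zero] at hcp
    exact ⟨hm, hr, by rw [h5]; congr 1; omega⟩

theorem run_visit (hb : 2 ≤ b) (hM : (M : ℤ) ≤ 2 ^ b) (hnN : n < N)
    (hσ : Base inp n N σ) {e : Expr} {a p x y : ℕ} (hok : e.Ok b M σ) (he : e.eval σ = a)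
    (haM : a < M) (ha : σ.mem a = p) (hpM : 9 * N + (p + 3) ≤ M)
    (hp : σ.mem (9 * N + (p + 2)) = y) (hx : x ≤ n) (hy : y ≤ n) (h12 : σ.reg 12 = x) :
    Run b M (visit e) σ fun τ => τ.mem = σ.mem ∧ τ.reg 12 = better (heightOf inp) x y ∧
      ∀ z, z ≠ 7 → z ≠ 12 → τ.reg z = σ.reg z := by
  have h4 := hσ.reg4
  refine Run.seq <| Run.load a p hok he haM ha <|
    Run.seq <| Run.load (9 * N + (p + 2)) y ?_ ?_ ?_ hp <|
    (run_pick (keySpec_heightKey hM (by omega) (by omega)) hb ((hσ.set ?_ ?_).set ?_ ?_) (x := x)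
    (y := y)
    ?_ ?_ hx hy).imp ?_
  rotate_right
  · rintro _ rfl
    refine ⟨rfl, by simp, fun z h7 h12 => by simp [h7, h12]⟩
  all_goals
    try simp [h4, h12]
    try unfold Fits
    try omega

theorem run_ite_visit (hb : 2 ≤ b) (hM : (M : ℤ) ≤ 2 ^ b) (hnN : n < N)
    (hσ : Base inp n N σ) {c e : Expr} {C : Prop} [Decidable C] {a p x y : ℕ} (hc : c.Ok b M σ)
    (hC : c.eval σ ≠ 0 ↔ C) (hok : e.Ok b M σ) (he : e.eval σ = a) (haM : a < M)
    (ha : σ.mem a = p) (hpM : 9 * N + (p + 3) ≤ M) (hp : σ.mem (9 * N + (p + 2)) = y) (hx : x ≤ n)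
    (hy : y ≤ n) (h12 : σ.reg 12 = x) :
    Run b M (.ite c (visit e) .skip) σ fun τ => τ.mem = σ.mem ∧
      τ.reg 12 = (if C then better (heightOf inp) x y else x : ℕ) ∧
      ∀ z, z ≠ 7 → z ≠ 12 → τ.reg z = σ.reg z := by
  refine Run.ite hc (fun h => ?_) (fun h => Run.skip ⟨rfl, ?_, fun z _ _ => rfl⟩)
  · rw [if_pos (hC.1 h)]
    exact run_visit hb hM hnN hσ hok he haM ha hpM hp hx hy h12
  · rw [if_neg fun h' => hC.2 h' h, h12]

theorem IsBest.better_ite {P Q : ℕ → Prop} {C : Prop} [Decidable C] {x y : ℕ} (hx : IsBest κ P x)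
    (hy : IsBest κ Q y) :
    IsBest κ (fun z => P z ∨ C ∧ Q z) (if C then WLSQ.better κ x y else x) := by
  split_ifs with h
  · exact (hx.better hy).congr fun z => by simp [h]
  · exact hx.congr fun z => by simp [h]

/-- The state of the descent at the height `h`: the current records are those of the blocks of
leaves that contain `A` and `B`, and the best code so far comes from the blocks between them. -/
structure DescentInv (n N : ℕ) (inp : ℕ → ℤ) (f : ℕ → ℕ) (lim A B : ℕ) (D : ℕ → ℤ) (h : ℕ)
    (σ : State) : Prop where
  mem : σ.mem = D
  base : Base inp n N σ
  reg6 : σ.reg 6 = (2 ^ h : ℕ)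
  reg10 : σ.reg 10 = A
  reg11 : σ.reg 11 = B
  left : ∃ p : ℕ, σ.reg 8 = p ∧
    Rep (heightOf inp) f (fun a => D (9 * N + a)) lim h (A / 2 ^ h) p
  right : ∃ p : ℕ, σ.reg 9 = p ∧
    Rep (heightOf inp) f (fun a => D (9 * N + a)) lim h (B / 2 ^ h) p
  best : ∃ x ≤ n, σ.reg 12 = (x : ℕ) ∧ IsBest (heightOf inp)
    (fun y => ∃ l, A / 2 ^ h < l / 2 ^ h ∧ l / 2 ^ h < B / 2 ^ h ∧ f l = y ∧ y ≠ 0) x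

/-- A block strictly between those of `A` and `B` at the height `h` is either in a block strictly
between them at the height `h + 1`, or the right sibling of the block of `A`, or the left sibling of
the block of `B`, where the siblings only count if the blocks at the height `h + 1` differ. -/
theorem DescentInv.step {f : ℕ → ℕ} {lim A B h : ℕ} {D : ℕ → ℤ} (hb : 2 ≤ b)
    (hM : (M : ℤ) ≤ 2 ^ b) (hnN : n < N) (hAN : A < N) (hBN : B < N) (hf : ∀ l, f l ≤ n)
    (hM' : 9 * N + lim ≤ M) (hh : 2 ^ (h + 1) ≤ N)
    (H : DescentInv n N inp f lim A B D (h + 1) σ) :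
    Run b M descendStep σ (DescentInv n N inp f lim A B D h) := by
  obtain ⟨p, h8, hp, -, pl, pr, hpl, hpr, hPl, hPr⟩ := H.left
  obtain ⟨q, h9, hq, -, ql, qr, hql, hqr, hQl, hQr⟩ := H.right
  obtain ⟨x, hxn, h12, hx⟩ := H.best
  have h4 := H.base.reg4
  have h6 := H.reg6
  have hA := div_two_pow_succ A h
  have hB := div_two_pow_succ B h
  have hAlt : A / 2 ^ h ≤ A := Nat.div_le_self _ _
  have hBlt : B / 2 ^ h ≤ B := Nat.div_le_self _ _
  obtain ⟨α, hα⟩ : ∃ α, A / 2 ^ h = α := ⟨_, rfl⟩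
  obtain ⟨β, hβ⟩ : ∃ β, B / 2 ^ h = β := ⟨_, rfl⟩
  have hαz : (A : ℤ) / 2 ^ h = α := by rw [← hα]; norm_cast
  have hβz : (B : ℤ) / 2 ^ h = β := by rw [← hβ]; norm_cast
  rw [hα] at hA hAlt
  rw [hβ] at hB hBlt
  have hs : 2 ^ (h + 1) = 2 * 2 ^ h := pow_succ' 2 h
  have hplim := hPl.le_lim
  have hprlim := hPr.le_lim
  have hqlim := hQl.le_lim
  have hqrlim := hQr.le_lim
  rw [hA] at hPl hPr
  rw [hB] at hQl hQr
  simp only [hA, hB] at hx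
  simp only [div_two_pow_succ _ h] at hx
  have hpre : Run b M findChildren σ fun τ => τ.mem = D ∧ τ.reg 6 = (2 ^ h : ℕ) ∧
      τ.reg 13 = (α % 2 : ℕ) ∧ τ.reg 14 = (β % 2 : ℕ) ∧
      τ.reg 15 = ((if α / 2 < β / 2 then 1 else 0 : ℕ) : ℤ) ∧
      ∀ y, y ≠ 6 → y < 13 → τ.reg y = σ.reg y := by
    refine Run.seq <| Run.assign (2 ^ h : ℕ) ?_ ?_ <|
      Run.seq <| Run.assign α ?_ ?_ <| Run.seq <| Run.assign β ?_ ?_ <|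
      Run.seq <| Run.assign (if α / 2 < β / 2 then 1 else 0 : ℕ) ?_ ?_ <|
      Run.seq <| Run.assign (α % 2 : ℕ) ?_ ?_ <| Run.assign (β % 2 : ℕ) ?_ ?_ ?_
    · simp only [Expr.ok_div, Expr.ok_reg, Expr.ok_ofNat, Expr.eval_reg, Expr.eval_ofNat, h6, Fits,
        true_and]
      omega
    · simp only [Expr.eval_div, Expr.eval_reg, Expr.eval_ofNat, h6]
      omega
    · simp [H.reg10, hαz, Fits]
      omega
    · simp [H.reg10, hαz]
    · simp [H.reg11, hβz, Fits]
      omega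
    · simp [H.reg11, hβz]
    · simp [Fits]
      omega
    · simp only [Expr.eval_lt, Expr.eval_div, Expr.eval_reg, State.reg_set, Expr.eval_ofNat]
      simp
      split_ifs <;> omega
    · simp [Fits]
      omega
    · simp
      omega
    · simp [Fits]
      omega
    · simp
      omega
    · refine ⟨H.mem, by simp, by simp, by simp, by simp, fun y hy6 hy => ?_⟩
      simp [hy6, show y ≠ 13 by omega, show y ≠ 14 by omega, show y ≠ 15 by omega]
  refine Run.seq <| hpre.imp ?_
  rintro τ ⟨hm, h6', h13, h14, h15, hr⟩
  have hBτ : Base inp n N τ := H.base.of_eq (hr 3 (by simp) (by simp)) (hr 4 (by simp) (by simp))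
    fun a _ => by rw [hm, H.mem]
  have h4' := hBτ.reg4
  have h8' : τ.reg 8 = p := by rw [hr 8 (by simp) (by simp), h8]
  have hα2 : α % 2 < 2 := Nat.mod_lt _ (by simp)
  have hβ2 : β % 2 < 2 := Nat.mod_lt _ (by simp)
  refine Run.seq <| (run_ite_visit hb hM hnN hBτ (C := α / 2 < β / 2 ∧ α % 2 = 0)
    (a := 9 * N + (p + 1)) (p := pr) (x := x) (y := WLSQ.best (heightOf inp) f h (2 * (α / 2) + 1))
    ?_ ?_ ?_ ?_ (by omega) (by rw [hm]; exact hpr) (by omega) (by rw [hm, ← hPr.val]) hxn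
    (best_le hf _ _)
    (by rw [hr 12 (by simp) (by simp), h12])).imp ?_
  · simp only [Expr.ok_mul, Expr.ok_sub, Expr.ok_reg, Expr.ok_ofNat, Expr.eval_reg, Expr.eval_sub,
      Expr.eval_ofNat, h13, h15, Fits, true_and]
    split_ifs <;> simp <;> omega
  · simp only [Expr.eval_mul, Expr.eval_reg, Expr.eval_sub, Expr.eval_ofNat, h13, h15]
    split_ifs with hC <;> simp [hC]
    omega
  · simp [h4', h8', Fits]
    omega
  · simp [h4', h8']
    omega
  rintro υ ⟨hm', h12', hr'⟩
  set x₁ := if α / 2 < β / 2 ∧ α % 2 = 0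
    then better (heightOf inp) x (WLSQ.best (heightOf inp) f h (2 * (α / 2) + 1)) else x with hx₁
  have hx₁n : x₁ ≤ n := by
    rw [hx₁]
    split_ifs
    exacts [better_le hxn (best_le hf _ _), hxn]
  have hBυ : Base inp n N υ := hBτ.of_eq (hr' 3 (by simp) (by simp)) (hr' 4 (by simp) (by simp))
    fun a _ => by rw [hm']
  have h4'' := hBυ.reg4
  have h9' : υ.reg 9 = q := by rw [hr' 9 (by simp) (by simp), hr 9 (by simp) (by simp), h9]
  have h14' : υ.reg 14 = (β % 2 : ℕ) := by rw [hr' 14 (by simp) (by simp), h14]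
  have h15' : υ.reg 15 = ((if α / 2 < β / 2 then 1 else 0 : ℕ) : ℤ) := by
    rw [hr' 15 (by simp) (by simp), h15]
  refine Run.seq <| (run_ite_visit hb hM hnN hBυ (C := α / 2 < β / 2 ∧ β % 2 = 1)
    (a := 9 * N + q) (p := ql) (x := x₁) (y := WLSQ.best (heightOf inp) f h (2 * (β / 2)))
    ?_ ?_ ?_ ?_ (by omega) (by rw [hm', hm]; exact hql) (by omega) (by rw [hm', hm, ← hQl.val]) hx₁n
    (best_le hf _ _) h12').imp ?_
  · simp only [Expr.ok_mul, Expr.ok_reg, Expr.eval_reg, h14', h15', Fits, true_and]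
    split_ifs <;> simp <;> omega
  · simp only [Expr.eval_mul, Expr.eval_reg, h14', h15']
    split_ifs with hC
    all_goals simp [hC]
    omega
  · simp [h4'', h9', Fits]
    omega
  · simp [h4'', h9']
  rintro ρ ⟨hm'', h12'', hr''⟩
  have hBρ : Base inp n N ρ := hBυ.of_eq (hr'' 3 (by simp) (by simp)) (hr'' 4 (by simp) (by simp))
    fun a _ => by rw [hm'']
  have h4ρ := hBρ.reg4
  have h8ρ : ρ.reg 8 = p := by rw [hr'' 8 (by simp) (by simp), hr' 8 (by simp) (by simp), h8']
  have h9ρ : ρ.reg 9 = q := by rw [hr'' 9 (by simp) (by simp), h9']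
  have h13ρ : ρ.reg 13 = (α % 2 : ℕ) := by
    rw [hr'' 13 (by simp) (by simp), hr' 13 (by simp) (by simp), h13]
  have h14ρ : ρ.reg 14 = (β % 2 : ℕ) := by rw [hr'' 14 (by simp) (by simp), h14']
  have hmρ : ρ.mem = D := by rw [hm'', hm', hm]
  obtain ⟨p', hp', hP'⟩ : ∃ p' : ℕ, D (9 * N + (p + α % 2)) = p' ∧
      Rep (heightOf inp) f (fun a => D (9 * N + a)) lim h α p' := by
    rcases Nat.mod_two_eq_zero_or_one α with h0 | h1
    · rw [show 2 * (α / 2) = α by omega] at hPl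
      exact ⟨pl, by rw [h0]; exact hpl, hPl⟩
    · rw [show 2 * (α / 2) + 1 = α by omega] at hPr
      exact ⟨pr, by rw [h1]; exact hpr, hPr⟩
  obtain ⟨q', hq', hQ'⟩ : ∃ q' : ℕ, D (9 * N + (q + β % 2)) = q' ∧
      Rep (heightOf inp) f (fun a => D (9 * N + a)) lim h β q' := by
    rcases Nat.mod_two_eq_zero_or_one β with h0 | h1
    · rw [show 2 * (β / 2) = β by omega] at hQl
      exact ⟨ql, by rw [h0]; exact hql, hQl⟩
    · rw [show 2 * (β / 2) + 1 = β by omega] at hQr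
      exact ⟨qr, by rw [h1]; exact hqr, hQr⟩
  refine Run.seq <| Run.load (9 * N + (p + α % 2)) p' ?_ ?_ ?_ (by rw [hmρ, hp']) <|
    Run.load (9 * N + (q + β % 2)) q' ?_ ?_ ?_ (by rw [State.mem_set, hmρ, hq'])
    ⟨hmρ, (hBρ.set (by simp) (by simp)).set (by simp) (by simp), ?_, ?_, ?_,
      ⟨p', by simp, hα ▸ hP'⟩, ⟨q', by simp, hβ ▸ hQ'⟩, ?_⟩
  · simp [h4ρ, h8ρ, h13ρ, Fits]
    omega
  · simp [h4ρ, h8ρ, h13ρ]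
    omega
  · omega
  · simp [h4ρ, h9ρ, h14ρ, Fits]
    omega
  · simp [h4ρ, h9ρ, h14ρ]
    omega
  · omega
  · simp [hr'' 6, hr' 6, h6']
  · simp [hr'' 10, hr' 10, hr 10, H.reg10]
  · simp [hr'' 11, hr' 11, hr 11, H.reg11]
  · have hx₁' := hx.better_ite (C := α / 2 < β / 2 ∧ α % 2 = 0)
      (isBest_best (heightOf inp) f h (2 * (α / 2) + 1))
    rw [← hx₁] at hx₁'
    refine ⟨if α / 2 < β / 2 ∧ β % 2 = 1
        then better (heightOf inp) x₁ (WLSQ.best (heightOf inp) f h (2 * (β / 2))) else x₁, ?_,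
      by simpa using h12'', (hx₁'.better_ite (C := α / 2 < β / 2 ∧ β % 2 = 1)
      (isBest_best (heightOf inp) f h (2 * (β / 2)))).congr fun y => ?_⟩
    · split_ifs
      exacts [better_le hx₁n (best_le hf _ _), hx₁n]
    · rw [hα, hβ]
      constructor
      · rintro ((⟨l, h1, h2, rfl, hy⟩ | ⟨⟨h1, h2⟩, hy, l, hl, rfl⟩) | ⟨⟨h1, h2⟩, hy, l, hl, rfl⟩)
        · exact ⟨l, by omega, by omega, rfl, hy⟩
        · exact ⟨l, by omega, by omega, rfl, hy⟩
        · exact ⟨l, by omega, by omega, rfl, hy⟩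
      · rintro ⟨l, h1, h2, rfl, hy⟩
        by_cases hl : l / 2 ^ h = 2 * (α / 2) + 1 ∧ α % 2 = 0
        · exact .inl (.inr ⟨⟨by omega, hl.2⟩, hy, l, hl.1, rfl⟩)
        by_cases hl' : l / 2 ^ h = 2 * (β / 2)
        · exact .inr ⟨⟨by omega, by omega⟩, hy, l, hl', rfl⟩
        · exact .inl (.inl ⟨l, by omega, by omega, rfl, hy⟩)

theorem runs_descend {f : ℕ → ℕ} {lim A B : ℕ} {D : ℕ → ℤ} (hb : 2 ≤ b)
    (hM : (M : ℤ) ≤ 2 ^ b) (hN : N = 2 ^ k) (hnN : n < N) (hAN : A < N) (hBN : B < N)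
    (hf : ∀ l, f l ≤ n) (hM' : 9 * N + lim ≤ M)
    (H : DescentInv n N inp f lim A B D k σ) :
    Runs b M descend σ (1000 * k + 10) (DescentInv n N inp f lim A B D 0) := by
  have hstep : descendStep.bound ≤ 900 := by decide
  have hb4 : (2 : ℤ) ^ 2 ≤ 2 ^ b := pow_le_pow_right₀ (by norm_num) hb
  have hloop := Runs.loop (b := b) (M := M) (σ := σ) (e := (1 : Expr).lt (.reg 6))
    (c := descendStep)
    (T := 900) (fun i => DescentInv n N inp f lim A B D (k - i)) k H ?_ ?_ ?_
  · rw [Nat.sub_self] at hloop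
    refine hloop.time_le ?_
    simp
    omega
  · intro i _ τ _
    simp [Fits]
    omega
  · intro i hi τ hτ
    have hki : k - i = k - (i + 1) + 1 := by omega
    have hlt : 1 < 2 ^ (k - i) := Nat.one_lt_two_pow (by omega)
    constructor
    · simp only [Expr.eval_lt, Expr.eval_ofNat, Expr.eval_reg, hτ.reg6, Nat.cast_lt]
      rw [if_pos hlt]
      simp
    · rw [hki] at hτ
      exact (hτ.step hb hM hnN hAN hBN hf hM'
        (hN ▸ Nat.pow_le_pow_right (by norm_num) (by omega))).runs hstep
  · intro τ hτ
    rw [Nat.sub_self] at hτ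
    simp [hτ.reg6]

end

/-! ### The query -/

/-- The event in register `7` is the left endpoint of a segment at or before the abscissa in
register `0`, or the right endpoint of a segment before it. -/
def eventTest : Expr :=
  (eventKey 7).lt (.reg 0) + (eventKey 7).eq (.reg 0) * (Expr.reg 7).lt (.reg 3 + 1)

/-- The weight of the segment in register `7` is below the range of the query. -/
def weightLtTest : Expr := (weightKey 7).lt (.reg 1)

/-- The weight of the segment in register `7` is not above the range of the query. -/
def weightLeTest : Expr := 1 - (Expr.reg 2).lt (weightKey 7)

/-- Sets the registers `14` and `15` for a search among the events. -/
def beforeVersion : Cmd :=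
  .assign 15 (4 * .reg 4) ;; .assign 14 (2 * .reg 3)

/-- Loads the root of the version that has been found, and sets the registers `14` and `15` for a
search among the weights. -/
def loadRoot : Cmd :=
  .assign 8 (.load (8 * .reg 4 + .reg 5)) ;; .assign 9 (.reg 8) ;; .assign 15 (6 * .reg 4) ;;
  .assign 14 (.reg 3)

/-- Starts the descent from the root, with no code found so far. -/
def beforeDescent : Cmd :=
  .assign 11 (.reg 5 + 1) ;; .assign 12 0 ;; .assign 6 (.reg 4)

/-- The query program. -/
def query : Cmd :=
  setup ;; beforeVersion ;; search eventTest ;; loadRoot ;; search weightLtTest ;;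
  .assign 10 (.reg 5) ;; search weightLeTest ;; beforeDescent ;; descend ;;
  .assign 0 (.reg 12 - 1)

/-- A property that earlier codes inherit cuts the sorted order at one position. -/
theorem exists_rank_threshold {κ : ℕ → ℤ} (m : ℕ) {P : ℕ → Prop}
    (hP : ∀ x y, Before κ y x → P x → P y) :
    ∃ c ≤ m, ∀ x ∈ Finset.Icc 1 m, (P x ↔ rank κ m x < c) := by
  classical
  refine ⟨((Finset.Icc 1 m).filter P).card, ?_, fun x hx => iff_rank_lt_card hP hx⟩
  simpa using Finset.card_filter_le (Finset.Icc 1 m) P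

section

variable {b M : ℕ} {inp : ℕ → ℤ} {n N k : ℕ} {σ : State}

/-- The segment with the code `x` matches the query. -/
def Candidate (inp : ℕ → ℤ) (n : ℕ) (v w₁ w₂ : ℤ) (x : ℕ) : Prop :=
  x ∈ Finset.Icc 1 n ∧ (inp (4 * x - 3) ≤ v ∧ v ≤ inp (4 * x - 2)) ∧
    (w₁ ≤ inp (4 * x) ∧ inp (4 * x) ≤ w₂)

/-- A query takes time proportional to `k`, leaves the memory as it is, and finds the lowest one of
the matching segments. -/
theorem runs_query {lim : ℕ} {D : ℕ → ℤ} {v w₁ w₂ : ℤ} (hb : 2 ≤ b) (hM : (M : ℤ) ≤ 2 ^ b)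
    (hk : k = Nat.clog 2 (2 * n + 2)) (hN : N = 2 ^ k) (hM' : 9 * N + lim ≤ M) (h0 : inp 0 = n)
    (hD : Stored n N k inp lim D) :
    Runs b M query (queryStart D v w₁ w₂) (1500 * k + 300) fun τ => τ.mem = D ∧
      ∃ x : ℕ, τ.reg 0 = x - 1 ∧ IsBest (heightOf inp) (Candidate inp n v w₁ w₂) x := by
  have hnN : 2 * n + 2 ≤ N := hN ▸ hk ▸ Nat.le_pow_clog (by norm_num) _
  have hb4 : (2 : ℤ) ^ 2 ≤ 2 ^ b := pow_le_pow_right₀ (by norm_num) hb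
  have hKe : KeySpec b M inp n N eventKey (abscissaOf n inp) (2 * n) :=
    keySpec_eventKey hM (by omega) (by omega) (by omega)
  have hKw : KeySpec b M inp n N weightKey (weightOf inp) n :=
    keySpec_weightKey hM (by omega) (by omega)
  obtain ⟨c, hc, hcv⟩ := exists_rank_threshold (κ := abscissaOf n inp) (2 * n)
    (P := fun x => abscissaOf n inp x < v ∨ abscissaOf n inp x = v ∧ x ≤ n) (by
      rintro x y hxy h
      unfold Before at hxy
      omega)
  obtain ⟨A, hA, hAw⟩ := exists_rank_threshold (κ := weightOf inp) n
    (P := fun x => weightOf inp x < w₁) (by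
      rintro x y hxy h
      unfold Before at hxy
      omega)
  obtain ⟨B, hB, hBw⟩ := exists_rank_threshold (κ := weightOf inp) n
    (P := fun x => weightOf inp x ≤ w₂) (by
      rintro x y hxy h
      unfold Before at hxy
      omega)
  obtain ⟨f, p, hf, hp, hP⟩ := hD.root c hc
  have hplim := hP.le_lim
  refine Runs.time_le (T₁ := 20 * k + 20 + (15 + (150 * k + 20 + (20 + (150 * k + 20 + (5 +
    (150 * k + 20 + (20 + (1000 * k + 10 + 10))))))))) (by omega) ?_
  refine Runs.seq <| (hk ▸ runs_setup (n := n) hM hb (hk ▸ hN) (by omega) ?_).imp ?_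
  · exact (hD.input 0 (by omega)).trans h0
  rintro τ ⟨hm, h3, h4, hr⟩
  replace hm : τ.mem = D := hm
  have hτ0 : τ.reg 0 = v := by rw [hr 0 (by simp) (by simp)]; rfl
  have hτ1 : τ.reg 1 = w₁ := by rw [hr 1 (by simp) (by simp)]; rfl
  have hτ2 : τ.reg 2 = w₂ := by rw [hr 2 (by simp) (by simp)]; rfl
  clear hr
  have hpre : Run b M beforeVersion τ fun υ =>
      υ = (τ.set 15 (4 * N : ℕ)).set 14 (2 * n : ℕ) := by
    refine Run.seq <| Run.assign (4 * N : ℕ) ?_ ?_ <| Run.assign (2 * n : ℕ) ?_ ?_ rfl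
    all_goals
      try simp [h3, h4]
      try unfold Fits
      try omega
  refine Runs.seq <| (hpre.runs (T := 15) (by decide)).imp ?_
  rintro _ rfl
  refine Runs.seq <| (runs_search (κ := abscissaOf n inp) (m := 2 * n) (c := c)
    (B := 4 * N) hb hM hN
    hc (by omega) (by omega) (by simp [h4]) (by simp) (by simp) (by decide) ?_ ?_).imp ?_
  · intro x hx
    simpa [hm] using hD.orders.event x hx
  · intro υ x hx hυm hυr hυ7
    have hυ0 : υ.reg 0 = v := by rw [hυr 0] <;> simp [hτ0]
    have hυB : Base inp n N υ := ⟨by rw [hυr 3] <;> simp [h3], by rw [hυr 4] <;> simp [h4],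
      fun a ha => by simpa [hυm, hm] using hD.input a ha⟩
    have hυ3 := hυB.reg3
    have hx1 := Finset.mem_Icc.1 hx
    rw [← hcv x hx]
    simp only [eventTest, Expr.ok_add, Expr.ok_lt, Expr.ok_mul, Expr.ok_eq, Expr.ok_reg,
      Expr.ok_ofNat, Expr.eval_add, Expr.eval_mul, Expr.eval_lt, Expr.eval_eq, Expr.eval_reg,
      Expr.eval_ofNat, hKe.ok υ 7 x hυB hυ7 hx1.1 hx1.2, hKe.eval υ 7 x hυB hυ7 hx1.1 hx1.2, hυ0,
      hυ3, hυ7, Fits]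
    constructor
    · split_ifs <;> simp <;> omega
    · split_ifs <;> simp <;> omega
  rintro υ ⟨hυm, hυr, hυ5⟩
  have hυ0 : υ.reg 1 = w₁ := by rw [hυr 1] <;> simp [hτ1]
  have hυ2 : υ.reg 2 = w₂ := by rw [hυr 2] <;> simp [hτ2]
  have hυ3 : υ.reg 3 = n := by rw [hυr 3] <;> simp [h3]
  have hυ4 : υ.reg 4 = N := by rw [hυr 4] <;> simp [h4]
  replace hυm : υ.mem = D := hυm.trans hm
  have hpre' : Run b M loadRoot υ fun ρ =>
      ρ = (((υ.set 8 p).set 9 p).set 15 (6 * N : ℕ)).set 14 n := by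
    refine Run.seq <| Run.load (8 * N + c) p ?_ ?_ ?_ (hυm ▸ hp) <| Run.seq <| Run.assign p ?_ ?_ <|
      Run.seq <| Run.assign (6 * N : ℕ) ?_ ?_ <| Run.assign n ?_ ?_ rfl
    all_goals
      try simp [hυ3, hυ4, hυ5]
      try unfold Fits
      try omega
  refine Runs.seq <| (hpre'.runs (T := 20) (by decide)).imp ?_
  rintro _ rfl
  refine Runs.seq <| (runs_search (κ := weightOf inp) (m := n) (c := A) (B := 6 * N) hb hM hN
    hA (by omega) (by omega) (by simp [hυ4]) (by simp) (by simp) (by decide) ?_ ?_).imp ?_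
  · intro x hx
    simpa [hυm] using hD.orders.weight x hx
  · intro ρ x hx hρm hρr hρ7
    have hρ1 : ρ.reg 1 = w₁ := by rw [hρr 1] <;> simp [hυ0]
    have hρB : Base inp n N ρ := ⟨by rw [hρr 3] <;> simp [hυ3], by rw [hρr 4] <;> simp [hυ4],
      fun a ha => by simpa [hρm, hυm] using hD.input a ha⟩
    have hx1 := Finset.mem_Icc.1 hx
    rw [← hAw x hx]
    simp [weightLtTest, hKw.ok ρ 7 x hρB hρ7 hx1.1 hx1.2, hKw.eval ρ 7 x hρB hρ7 hx1.1 hx1.2, hρ1]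
    omega
  rintro ρ ⟨hρm, hρr, hρ5⟩
  replace hρm : ρ.mem = D := hρm.trans hυm
  have hρ2 : ρ.reg 2 = w₂ := by rw [hρr 2] <;> simp [hυ2]
  have hρ3 : ρ.reg 3 = n := by rw [hρr 3] <;> simp [hυ3]
  have hρ4 : ρ.reg 4 = N := by rw [hρr 4] <;> simp [hυ4]
  have hρ8 : ρ.reg 8 = p := by rw [hρr 8] <;> simp
  have hρ9 : ρ.reg 9 = p := by rw [hρr 9] <;> simp
  have hρ14 : ρ.reg 14 = n := by rw [hρr 14] <;> simp
  have hρ15 : ρ.reg 15 = (6 * N : ℕ) := by rw [hρr 15] <;> simp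
  refine Runs.seq <| (Run.assign A (by simp) (by simp [hρ5]) ?_).runs (T := 5) (by decide)
  refine Runs.seq <| (runs_search (κ := weightOf inp) (m := n) (c := B) (B := 6 * N) hb hM hN
    hB (by omega) (by omega) (by simp [hρ4]) (by simp [hρ14]) (by simp [hρ15])
      (by decide) ?_ ?_).imp ?_
  · intro x hx
    simpa [hρm] using hD.orders.weight x hx
  · intro π x hx hπm hπr hπ7
    have hπ2 : π.reg 2 = w₂ := by rw [hπr 2] <;> simp [hρ2]
    have hπB : Base inp n N π := ⟨by rw [hπr 3] <;> simp [hρ3], by rw [hπr 4] <;> simp [hρ4],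
      fun a ha => by simpa [hπm, hρm] using hD.input a ha⟩
    have hx1 := Finset.mem_Icc.1 hx
    rw [← hBw x hx]
    simp only [weightLeTest, Expr.ok_sub, Expr.ok_ofNat, Expr.ok_lt, Expr.ok_reg, Expr.eval_sub,
      Expr.eval_ofNat, Expr.eval_lt, Expr.eval_reg, hKw.ok π 7 x hπB hπ7 hx1.1 hx1.2,
      hKw.eval π 7 x hπB hπ7 hx1.1 hx1.2, hπ2, Fits]
    constructor
    · split_ifs <;> simp <;> omega
    · split_ifs <;> simp <;> omega
  rintro π ⟨hπm, hπr, hπ5⟩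
  replace hπm : π.mem = D := hπm.trans hρm
  have hπ3 : π.reg 3 = n := by rw [hπr 3] <;> simp [hρ3]
  have hπ4 : π.reg 4 = N := by rw [hπr 4] <;> simp [hρ4]
  have hπ8 : π.reg 8 = p := by rw [hπr 8] <;> simp [hρ8]
  have hπ9 : π.reg 9 = p := by rw [hπr 9] <;> simp [hρ9]
  have hπ10 : π.reg 10 = A := by rw [hπr 10] <;> simp
  have hpre'' : Run b M beforeDescent π fun ω =>
      ω = ((π.set 11 (B + 1 : ℕ)).set 12 (0 : ℕ)).set 6 N := by
    refine Run.seq <| Run.assign (B + 1 : ℕ) ?_ ?_ <| Run.seq <| Run.assign (0 : ℕ) ?_ ?_ <|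
      Run.assign N ?_ ?_ rfl
    all_goals
      try simp [hπ4, hπ5]
      try unfold Fits
      try omega
  refine Runs.seq <| (hpre''.runs (T := 20) (by decide)).imp ?_
  rintro _ rfl
  have hA0 : A / 2 ^ k = 0 := Nat.div_eq_of_lt (by omega)
  have hB0 : (B + 1) / 2 ^ k = 0 := Nat.div_eq_of_lt (by omega)
  have hstart : DescentInv n N inp f lim A (B + 1) D k
      (((π.set 11 (B + 1 : ℕ)).set 12 (0 : ℕ)).set 6 N) := by
    refine ⟨hπm, ⟨by simp [hπ3], by simp [hπ4], fun a ha => ?_⟩, by simp [hN], by simp [hπ10],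
      by simp, ⟨p, by simp [hπ8], hA0 ▸ hP⟩, ⟨p, by simp [hπ9], hB0 ▸ hP⟩, 0, by simp, by simp,
      .inl ⟨rfl, ?_⟩⟩
    · simpa [hπm] using hD.input a ha
    · rintro y ⟨l, h1, h2, -⟩
      omega
  refine Runs.seq <| (runs_descend hb hM hN (by omega) (by omega)
    (by omega) hf.le hM' hstart).imp ?_
  rintro ω ⟨hωm, -, -, -, -, -, -, x, hxn, hω12, hx⟩
  refine (Run.assign (x - 1 : ℤ) ?_ ?_ ⟨hωm, x, by simp, ?_⟩).runs (by decide)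
  · simp [hω12, Fits]
    omega
  · simp [hω12]
  refine hx.congr fun y => ?_
  simp only [pow_zero, Nat.div_one]
  -- The three thresholds translate ranks back into conditions on the segment.
  have key : y ∈ Finset.Icc 1 n → ((Active n inp c y ↔ inp (4 * y - 3) ≤ v ∧ v ≤ inp (4 * y - 2)) ∧
      (A ≤ rank (weightOf inp) n y ↔ w₁ ≤ inp (4 * y)) ∧
      (rank (weightOf inp) n y < B ↔ inp (4 * y) ≤ w₂)) := by
    intro hy
    have hy1 := Finset.mem_Icc.1 hy
    have h1 := hcv y (Finset.mem_Icc.2 (by omega))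
    have h2 := hcv (n + y) (Finset.mem_Icc.2 (by omega))
    have h3 := hAw y hy
    have h4 := hBw y hy
    simp only [abscissaOf, if_pos hy1.2] at h1
    simp only [abscissaOf, if_neg (show ¬ n + y ≤ n by omega), show n + y - n = y by omega] at h2
    simp only [weightOf] at h3 h4
    unfold Active
    refine ⟨?_, ?_, ?_⟩
    · rw [← h1, ← not_lt (a := rank (abscissaOf n inp) (2 * n) (n + y)), ← h2]
      omega
    · rw [← not_lt, ← h3, not_lt]
    · exact h4.symm
  constructor
  · rintro ⟨l, h1, h2, hy, hy0⟩
    obtain ⟨hyn, hl, hact⟩ := (hf l y hy0).1 hy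
    obtain ⟨k1, k2, k3⟩ := key hyn
    exact ⟨hyn, k1.1 hact, k2.1 (by omega), k3.1 (by omega)⟩
  · rintro ⟨hyn, hv, hw1, hw2⟩
    obtain ⟨k1, k2, k3⟩ := key hyn
    have hy1 := Finset.mem_Icc.1 hyn
    have h1 := k2.2 hw1
    have h2 := k3.2 hw2
    exact ⟨rank (weightOf inp) n y + 1, by omega, by omega,
      (hf _ y (by omega)).2 ⟨hyn, rfl, k1.2 hv⟩, by omega⟩

end

/-! ### Input format and bounds -/

theorem inputMem_of_lt (S : List Segment) {i : ℕ} (hi : i < S.length) :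
    inputMem S (4 * i + 1) = S[i].left ∧ inputMem S (4 * i + 2) = S[i].right ∧
      inputMem S (4 * i + 3) = S[i].height ∧ inputMem S (4 * i + 4) = S[i].weight := by
  induction S generalizing i with
  | nil => simp at hi
  | cons s S ih =>
    cases i with
    | zero => simp [inputMem]
    | succ i =>
      have := ih (i := i) (by simpa using hi)
      simpa [inputMem, Nat.mul_add] using this

theorem inputMem_of_gt (S : List Segment) {a : ℕ} (ha : 4 * S.length < a) : inputMem S a = 0 := by
  unfold inputMem
  rw [List.getD_eq_default]
  simp [List.length_flatMap]
  omega

/-- Codes are indices shifted by one, so that the absent code `0` becomes the answer `-1`. -/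
theorem isAnswer_of_isBest {S : List Segment} {v w₁ w₂ : ℤ} {x : ℕ}
    (hx : IsBest (heightOf (inputMem S)) (Candidate (inputMem S) S.length v w₁ w₂) x) :
    IsAnswer S v w₁ w₂ (x - 1) := by
  have key : ∀ i (hi : i < S.length), Candidate (inputMem S) S.length v w₁ w₂ (i + 1) ↔
      S[i].Matches v w₁ w₂ := by
    intro i hi
    obtain ⟨h1, h2, -, h4⟩ := inputMem_of_lt S hi
    unfold Candidate Segment.Matches
    rw [show 4 * (i + 1) - 3 = 4 * i + 1 by omega, show 4 * (i + 1) - 2 = 4 * i + 2 by omega,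
      show 4 * (i + 1) = 4 * i + 4 by omega, h1, h2, h4]
    simp
    omega
  rcases hx with ⟨rfl, h⟩ | ⟨hx0, hx, h⟩
  · refine .inl ⟨by simp, fun s hs hm => ?_⟩
    obtain ⟨i, hi, rfl⟩ := List.mem_iff_getElem.1 hs
    exact h _ ((key i hi).2 hm)
  · obtain ⟨i, rfl⟩ := Nat.exists_eq_succ_of_ne_zero hx0
    have hi : i < S.length := by
      have := Finset.mem_Icc.1 hx.1
      omega
    refine .inr ⟨⟨i, hi⟩, by simp, (key i hi).1 hx, fun s hs hm => ?_⟩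
    obtain ⟨j, hj, rfl⟩ := List.mem_iff_getElem.1 hs
    have := h _ ((key j hj).2 hm)
    have hii := (inputMem_of_lt S hi).2.2.1
    have hjj := (inputMem_of_lt S hj).2.2.1
    unfold Before heightOf at this
    rw [show 4 * (j + 1) - 1 = 4 * j + 3 by omega, show 4 * i.succ - 1 = 4 * i + 3 by omega,
      hii, hjj] at this
    simp only [List.get_eq_getElem]
    omega

theorem clog_le_log_add_two (n : ℕ) : Nat.clog 2 (2 * n + 2) ≤ Nat.log 2 n + 2 := by
  apply Nat.clog_le_of_le_pow
  have := Nat.lt_pow_succ_log_self (b := 2) (by norm_num) n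
  rw [pow_succ]
  omega

theorem two_pow_clog_le (n : ℕ) : 2 ^ Nat.clog 2 (2 * n + 2) ≤ 4 * n + 4 := by
  have h := Nat.pow_pred_clog_lt_self (b := 2) (by norm_num) (x := 2 * n + 2) (by omega)
  have hpos : 0 < Nat.clog 2 (2 * n + 2) := Nat.clog_pos (by norm_num) (by omega)
  have hs : 2 ^ Nat.clog 2 (2 * n + 2) = 2 * 2 ^ (Nat.clog 2 (2 * n + 2)).pred := by
    rw [← pow_succ', Nat.pred_eq_sub_one, Nat.sub_add_cancel hpos]
  omega

/-- The bound on memory and time also holds for `n = 0` and `n = 1`, where the logarithm vanishes.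
-/
theorem mul_log_add_le (n : ℕ) : n * (Nat.log 2 n + 3) ≤ 4 * (n * Nat.log 2 n + 1) := by
  rcases Nat.lt_or_ge n 2 with h | h
  · interval_cases n <;> simp
  · have : n * 1 ≤ n * Nat.log 2 n := Nat.mul_le_mul_left n (Nat.log_pos (by norm_num) h)
    rw [Nat.mul_add]
    omega

end WLSQ

/-- There are a preprocessing program, a query program and a constant `C` such that, for every word
length and every input `S` of `n` segments that fits, the preprocessing turns the input into a
data structure `D` of `M = C (n log n + 1)` memory cells in at most `C (n log n + 1)` steps (without
using more memory), and every query is then answered from `D`, which it leaves unchanged, in at most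
`C (log n + 1)` steps. -/
theorem mainTheorem4 :
    ∃ (build query : WLSQ.Cmd) (C : ℕ), ∀ (b : ℕ) (S : List WLSQ.Segment) (n M : ℕ),
      n = S.length →
      M = C * (n * Nat.log 2 n + 1) →
      -- the input consists of words, and every address is a word
      (∀ s ∈ S, s.Fits b) →
      M ≤ 2 ^ b →
      ∃ (D r : ℕ → ℤ) (t : ℕ),
        t ≤ C * (n * Nat.log 2 n + 1) ∧
        WLSQ.Exec b M build (WLSQ.buildStart S) t ⟨r, D⟩ ∧
        ∀ v w₁ w₂ : ℤ, WLSQ.Fits b v → WLSQ.Fits b w₁ → WLSQ.Fits b w₂ →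
          ∃ (r' : ℕ → ℤ) (t' : ℕ),
            t' ≤ C * (Nat.log 2 n + 1) ∧
            WLSQ.Exec b M query (WLSQ.queryStart D v w₁ w₂) t' ⟨r', D⟩ ∧
            WLSQ.IsAnswer S v w₁ w₂ (r' 0) := by
  refine ⟨WLSQ.build, WLSQ.query, 20000, fun b S n M hn hM _ hMb => ?_⟩
  obtain ⟨k, hk⟩ : ∃ k, k = Nat.clog 2 (2 * n + 2) := ⟨_, rfl⟩
  have hklog := WLSQ.clog_le_log_add_two n
  have hN := WLSQ.two_pow_clog_le n
  rw [← hk] at hklog hN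
  have hnk : n * (k + 1) ≤ 4 * (n * Nat.log 2 n + 1) :=
    (Nat.mul_le_mul_left n (by omega)).trans (WLSQ.mul_log_add_le n)
  have hnn : n * 1 ≤ n * (k + 1) := Nat.mul_le_mul_left n (by omega)
  have hlog : Nat.log 2 n ≤ n * Nat.log 2 n := by
    rcases Nat.eq_zero_or_pos n with rfl | h
    · simp
    · exact Nat.le_mul_of_pos_left _ h
  have hd : n * (3 * (k + 1)) = 3 * (n * (k + 1)) := by ring
  have hb : 2 ≤ b := by
    by_contra! h
    have : 2 ^ b ≤ 2 ^ 2 := Nat.pow_le_pow_right (by norm_num) h.le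
    omega
  have hMb' : (M : ℤ) ≤ 2 ^ b := by exact_mod_cast hMb
  have h0 : WLSQ.inputMem S 0 = n := by simp [WLSQ.inputMem, hn]
  obtain ⟨t, ⟨r, D⟩, ht, hexec, lim, hlim, hD⟩ := WLSQ.runs_build (b := b) (M := M) (n := n)
    (inp := WLSQ.inputMem S) (σ := WLSQ.buildStart S) hb hMb' hk rfl (by omega) h0
    (fun a ha => WLSQ.inputMem_of_gt S (by omega)) rfl (by
      intro x hx
      rw [Finset.mem_Icc] at hx
      obtain ⟨h1, h2, -, -⟩ := WLSQ.inputMem_of_lt S (i := x - 1) (by omega)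
      rw [show 4 * x - 3 = 4 * (x - 1) + 1 by omega, show 4 * x - 2 = 4 * (x - 1) + 2 by omega,
        h1, h2]
      exact WLSQ.Segment.left_le_right _)
  refine ⟨D, r, t, by omega, hexec, fun v w₁ w₂ _ _ _ => ?_⟩
  obtain ⟨t', ⟨r', D'⟩, ht', hexec', rfl, x, hx0, hx⟩ := WLSQ.runs_query (v := v) (w₁ := w₁)
    (w₂ := w₂) hb hMb' hk rfl hlim h0 hD
  refine ⟨r', t', by omega, hexec', ?_⟩
  rw [show r' 0 = x - 1 from hx0]
  subst hn
  exact WLSQ.isAnswer_of_isBest hx
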